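/- For $K\in L^2(0,2\pi)$ let $P_{1,K}$ be the operator in $L^2(0,2\pi)$ with $\operatorname{dom}(P_{1,K})=\{f\in H^1(0,2\pi) : f(0)=f(2\pi)\}$ and $(P_{1,K}f)(x)=if'(x)+f(2\pi)K(x)$; it is densely defined, and $P_{1,K}^*$ denotes its Hilbert space adjoint. For an operator $A$ in a Hilbert space and $\mu\in\mathbb C$, the root space is $\mathcal R(\mu,A)=\{f : (A-\mu)^kf=0 \text{ for some } k\in\mathbb N\}$; its elements are called root vectors. A sequence $\{f_n\}_{n\in\mathbb Z}$ in a Hilbert space $\mathcal H$ is a Riesz basis of $\mathcal H$ if there are a bounded and boundedly invertible operator $S:\mathcal H\to\mathcal H$ and an orthonormal basis $\{\psi_n\}_{n\in\mathbb Z}$ of $\mathcal H$ with $f_n=S\psi_n$ for all $n\in\mathbb Z$. Theorem. For every $K\in L^2(0,2\pi)$, the root vectors of $P_{1,K}$ form a Riesz basis of $L^2(0,2\pi)$, and so do the root vectors of $P_{1,K}^*$. Precisely, for each of the two operators $A\in\{P_{1,K},P_{1,K}^*\}$: (a) there is a sequence $\{f_n\}_{n\in\mathbb Z}$ of unit vectors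 made up of bases of all the root spaces of $A$, i.e. there are $\lambda_n\in\mathbb C$ $(n\in\mathbb Z)$ such that for every $\mu\in\mathbb C$ the vectors $f_n$ with $\lambda_n=\mu$ are linearly independent and span $\mathcal R(\mu,A)$; (b) every sequence $\{f_n\}_{n\in\mathbb Z}$ made up of bases of all the root spaces of $A$ in this sense and with $0<\inf_n\|f_n\|\le\sup_n\|f_n\|<\infty$ is a Riesz basis of $L^2(0,2\pi)$. -/

import Mathlib

noncomputable section

open MeasureTheory Set
open scoped ContDiff

namespace NonlocalMomentum

/-- Lebesgue measure on the interval `(0, 2π)`. -/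
abbrev intervalMeasure : Measure ℝ := volume.restrict (Ioo 0 (2 * Real.pi))

/-- The complex Hilbert space `L²(0, 2π)`. -/
abbrev L2 : Type := Lp ℂ 2 intervalMeasure

/-- `g ∈ L²(0, 2π)` is the weak derivative of `f ∈ L²(0, 2π)`; thus `f ∈ H¹(0, 2π)` exactly if
such a `g` exists. -/
def HasWeakDeriv (f g : L2) : Prop :=
  ∀ φ : ℝ → ℝ, ContDiff ℝ ∞ φ → HasCompactSupport φ → tsupport φ ⊆ Ioo 0 (2 * Real.pi) →
    ∫ x in Ioo 0 (2 * Real.pi), deriv φ x • f x = - ∫ x in Ioo 0 (2 * Real.pi), φ x • g x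

/-- `F` is a representative of `f` that is continuous up to the end points of the interval. Every
element of `H¹(0, 2π)` has one, and its values at `0` and `2π` are the boundary values of `f`. -/
def IsContinuousRep (f : L2) (F : ℝ → ℂ) : Prop :=
  ContinuousOn F (Icc 0 (2 * Real.pi)) ∧ f =ᵐ[intervalMeasure] F

/-- `f` lies in `H¹(0, 2π)`, satisfies `f(0) = f(2π)`, and `h = i f' + f(2π) K`. -/
def ActsAs (K f h : L2) : Prop :=
  ∃ (g : L2) (F : ℝ → ℂ), HasWeakDeriv f g ∧ IsContinuousRep f F ∧
    F 0 = F (2 * Real.pi) ∧ h = Complex.I • g + F (2 * Real.pi) • K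

theorem integrable_smul {ψ : ℝ → ℝ} (hψ : Continuous ψ) (hc : HasCompactSupport ψ) (f : L2) :
    Integrable (fun x => ψ x • f x) intervalMeasure := by
  have hf : Integrable f intervalMeasure := (Lp.memLp f).integrable (by norm_num)
  obtain ⟨C, hC⟩ := hc.exists_bound_of_continuous hψ
  exact hf.bdd_smul C hψ.aestronglyMeasurable (Filter.Eventually.of_forall hC)

theorem HasWeakDeriv.add {f₁ f₂ g₁ g₂ : L2} (h₁ : HasWeakDeriv f₁ g₁) (h₂ : HasWeakDeriv f₂ g₂) :
    HasWeakDeriv (f₁ + f₂) (g₁ + g₂) := by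
  intro φ hφ hc hs
  have e₁ : ∫ x in Ioo 0 (2 * Real.pi), deriv φ x • (f₁ + f₂ : L2) x
      = ∫ x in Ioo 0 (2 * Real.pi), (deriv φ x • f₁ x + deriv φ x • f₂ x) := by
    refine integral_congr_ae ?_
    filter_upwards [Lp.coeFn_add f₁ f₂] with x hx
    rw [hx, Pi.add_apply, smul_add]
  have e₂ : ∫ x in Ioo 0 (2 * Real.pi), φ x • (g₁ + g₂ : L2) x
      = ∫ x in Ioo 0 (2 * Real.pi), (φ x • g₁ x + φ x • g₂ x) := by
    refine integral_congr_ae ?_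
    filter_upwards [Lp.coeFn_add g₁ g₂] with x hx
    rw [hx, Pi.add_apply, smul_add]
  have hd : Continuous (deriv φ) := hφ.continuous_deriv (by simp)
  rw [e₁, e₂, integral_add (integrable_smul hd hc.deriv f₁) (integrable_smul hd hc.deriv f₂),
    integral_add (integrable_smul hφ.continuous hc g₁) (integrable_smul hφ.continuous hc g₂),
    h₁ φ hφ hc hs, h₂ φ hφ hc hs]
  ring

theorem HasWeakDeriv.smul {f g : L2} (c : ℂ) (h : HasWeakDeriv f g) :
    HasWeakDeriv (c • f) (c • g) := by
  intro φ hφ hc hs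
  have e₁ : ∫ x in Ioo 0 (2 * Real.pi), deriv φ x • (c • f : L2) x
      = ∫ x in Ioo 0 (2 * Real.pi), c • (deriv φ x • f x) := by
    refine integral_congr_ae ?_
    filter_upwards [Lp.coeFn_smul c f] with x hx
    rw [hx, Pi.smul_apply, smul_comm]
  have e₂ : ∫ x in Ioo 0 (2 * Real.pi), φ x • (c • g : L2) x
      = ∫ x in Ioo 0 (2 * Real.pi), c • (φ x • g x) := by
    refine integral_congr_ae ?_
    filter_upwards [Lp.coeFn_smul c g] with x hx
    rw [hx, Pi.smul_apply, smul_comm]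
  rw [e₁, e₂, integral_smul, integral_smul, h φ hφ hc hs, smul_neg]

theorem HasWeakDeriv.eq_zero {g : L2} (h : HasWeakDeriv 0 g) : g = 0 := by
  have hg : Integrable g intervalMeasure := (Lp.memLp g).integrable (by norm_num)
  have key := (isOpen_Ioo (a := (0 : ℝ)) (b := 2 * Real.pi)).ae_eq_zero_of_integral_contDiff_smul_eq_zero
    (μ := volume) (f := (g : ℝ → ℂ)) (IntegrableOn.locallyIntegrableOn hg) (by
      intro φ hφ hc hs
      have h0 : ∫ x in Ioo 0 (2 * Real.pi), deriv φ x • (0 : L2) x = 0 := by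
        refine integral_eq_zero_of_ae ?_
        filter_upwards [Lp.coeFn_zero ℂ 2 intervalMeasure] with x hx
        rw [hx]; simp
      have h1 := h φ hφ hc hs
      rw [h0, zero_eq_neg] at h1
      rw [← h1, setIntegral_eq_integral_of_forall_compl_eq_zero]
      intro x hx
      rw [image_eq_zero_of_notMem_tsupport (fun hx' => hx (hs hx')), zero_smul])
  rw [Lp.eq_zero_iff_ae_eq_zero]
  exact (ae_restrict_iff' measurableSet_Ioo).2 key

theorem IsContinuousRep.eq_zero {F : ℝ → ℂ} (h : IsContinuousRep 0 F) :
    EqOn F 0 (Icc 0 (2 * Real.pi)) := by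
  refine Measure.eqOn_Icc_of_ae_eq volume (by positivity) ?_ h.1 continuousOn_const
  rw [← restrict_Ioo_eq_restrict_Icc]
  exact h.2.symm.trans (Lp.coeFn_zero ℂ 2 intervalMeasure)

/-- The graph of `P_{1,K}`. -/
def momentumGraph (K : L2) : Submodule ℂ (L2 × L2) where
  carrier := {p | ActsAs K p.1 p.2}
  zero_mem' := by
    refine ⟨0, 0, ?_, ⟨continuousOn_const, Lp.coeFn_zero ℂ 2 intervalMeasure⟩, rfl, by simp⟩
    simpa using HasWeakDeriv.smul (0 : ℂ) (f := 0) (g := 0) (by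
      intro φ hφ hc hs
      rw [integral_eq_zero_of_ae, integral_eq_zero_of_ae, neg_zero]
      all_goals
        filter_upwards [Lp.coeFn_zero ℂ 2 intervalMeasure] with x hx
        rw [hx]; simp)
  add_mem' := by
    rintro _ _ ⟨g₁, F₁, hg₁, hF₁, hb₁, hh₁⟩ ⟨g₂, F₂, hg₂, hF₂, hb₂, hh₂⟩
    refine ⟨g₁ + g₂, F₁ + F₂, hg₁.add hg₂,
      ⟨hF₁.1.add hF₂.1, (Lp.coeFn_add _ _).trans (hF₁.2.add hF₂.2)⟩, ?_, ?_⟩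
    · simp [hb₁, hb₂]
    · rw [Prod.snd_add, hh₁, hh₂, Pi.add_apply, smul_add, add_smul]
      abel
  smul_mem' := by
    rintro c _ ⟨g, F, hg, hF, hb, hh⟩
    refine ⟨c • g, c • F, hg.smul c,
      ⟨hF.1.const_smul c, (Lp.coeFn_smul c _).trans (hF.2.const_smul c)⟩, ?_, ?_⟩
    · simp [hb]
    · rw [Prod.smul_snd, hh, Pi.smul_apply, smul_add, smul_comm, smul_assoc]

/-- The (unbounded) operator `P_{1,K}` in `L²(0, 2π)`, with domain
`{f ∈ H¹(0, 2π) | f(0) = f(2π)}` and action `f ↦ i f' + f(2π) K`. -/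
def momentumOp (K : L2) : L2 →ₗ.[ℂ] L2 := (momentumGraph K).toLinearPMap

/-- `P_{1,K}` has the intended domain and action. -/
theorem mem_graph_momentumOp (K f h : L2) : (f, h) ∈ (momentumOp K).graph ↔ ActsAs K f h := by
  have := Submodule.toLinearPMap_graph_eq (momentumGraph K) (by
    rintro ⟨f, h⟩ ⟨g, F, hg, hF, -, rfl⟩ (rfl : f = 0)
    rw [hg.eq_zero, hF.eq_zero (right_mem_Icc.2 (by positivity))]
    simp)
  rw [momentumOp, this]
  rfl

/-- `P_{1,K}` is densely defined, so that its Hilbert space adjoint makes sense. -/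
theorem dense_domain_momentumOp (K : L2) : Dense ((momentumOp K).domain : Set L2) := by
  rw [Submodule.dense_iff_topologicalClosure_eq_top, Submodule.topologicalClosure_eq_top_iff,
    Submodule.eq_bot_iff]
  intro u hu
  rw [Submodule.mem_orthogonal] at hu
  have hui : Integrable u intervalMeasure := (Lp.memLp u).integrable (by norm_num)
  have key := (isOpen_Ioo (a := (0 : ℝ)) (b := 2 * Real.pi)).ae_eq_zero_of_integral_contDiff_smul_eq_zero
    (μ := volume) (f := (u : ℝ → ℂ)) (IntegrableOn.locallyIntegrableOn hui) (by
      intro φ hφ hc hs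
      have hφ0 : ∀ x, x ∉ Ioo 0 (2 * Real.pi) → φ x = 0 := fun x hx =>
        image_eq_zero_of_notMem_tsupport (fun hx' => hx (hs hx'))
      have hd : Continuous (deriv φ) := hφ.continuous_deriv (by simp)
      have m₁ : MemLp (fun x => (φ x : ℂ)) 2 intervalMeasure :=
        MemLp.mono_measure Measure.restrict_le_self
          ((Complex.continuous_ofReal.comp hφ.continuous).memLp_of_hasCompactSupport
            (hc.comp_left (g := Complex.ofReal) Complex.ofReal_zero))
      have m₂ : MemLp (fun x => Complex.ofReal (deriv φ x)) 2 intervalMeasure :=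
        MemLp.mono_measure Measure.restrict_le_self
          ((Complex.continuous_ofReal.comp hd).memLp_of_hasCompactSupport
            (hc.deriv.comp_left (g := Complex.ofReal) Complex.ofReal_zero))
      have hmem : ((m₁.toLp _ : L2), Complex.I • (m₂.toLp _ : L2)) ∈ (momentumOp K).graph := by
        rw [mem_graph_momentumOp]
        refine ⟨(m₂.toLp _ : L2), fun x => (φ x : ℂ), ?_,
          ⟨(Complex.continuous_ofReal.comp hφ.continuous).continuousOn, m₁.coeFn_toLp⟩, ?_, ?_⟩
        · intro χ hχ hχc hχs
          have e₁ : ∫ x in Ioo 0 (2 * Real.pi), deriv χ x • (m₁.toLp _ : L2) x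
              = ∫ x, ((deriv χ x * φ x : ℝ) : ℂ) := by
            trans ∫ x in Ioo 0 (2 * Real.pi), ((deriv χ x * φ x : ℝ) : ℂ)
            · refine integral_congr_ae ?_
              filter_upwards [m₁.coeFn_toLp] with x hx
              rw [hx]; simp
            · refine setIntegral_eq_integral_of_forall_compl_eq_zero fun x hx => ?_
              rw [hφ0 x hx]; simp
          have e₂ : ∫ x in Ioo 0 (2 * Real.pi), χ x • (m₂.toLp _ : L2) x
              = ∫ x, ((χ x * deriv φ x : ℝ) : ℂ) := by
            trans ∫ x in Ioo 0 (2 * Real.pi), ((χ x * deriv φ x : ℝ) : ℂ)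
            · refine integral_congr_ae ?_
              filter_upwards [m₂.coeFn_toLp] with x hx
              rw [hx]; simp
            · refine setIntegral_eq_integral_of_forall_compl_eq_zero fun x hx => ?_
              rw [image_eq_zero_of_notMem_tsupport (fun hx' => hx (hχs hx'))]; simp
          have hdχ : Continuous (deriv χ) := hχ.continuous_deriv (by simp)
          rw [e₁, e₂, integral_complex_ofReal, integral_complex_ofReal,
            integral_mul_deriv_eq_deriv_mul_of_integrable (u := χ) (v := φ) (u' := deriv χ)
              (v' := deriv φ)
              (fun x _ => (hχ.differentiable (by simp) x).hasDerivAt)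
              (fun x _ => (hφ.differentiable (by simp) x).hasDerivAt)]
          · simp
          · exact (hχ.continuous.mul hd).integrable_of_hasCompactSupport hχc.mul_right
          · exact (hdχ.mul hφ.continuous).integrable_of_hasCompactSupport hχc.deriv.mul_right
          · exact (hχ.continuous.mul hφ.continuous).integrable_of_hasCompactSupport hχc.mul_right
        · simp [hφ0 0 (by simp), hφ0 (2 * Real.pi) (by simp)]
        · simp [hφ0 (2 * Real.pi) (by simp)]
      have h0 := hu _ (LinearPMap.mem_domain_of_mem_graph hmem)
      rw [L2.inner_def] at h0
      rw [← setIntegral_eq_integral_of_forall_compl_eq_zero (s := Ioo 0 (2 * Real.pi)), ← h0]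
      · refine integral_congr_ae ?_
        filter_upwards [m₁.coeFn_toLp] with x hx
        rw [hx]; simp [mul_comm]
      · intro x hx
        rw [hφ0 x hx, zero_smul])
  rw [Lp.eq_zero_iff_ae_eq_zero]
  exact (ae_restrict_iff' measurableSet_Ioo).2 key

section General

variable {H : Type*} [NormedAddCommGroup H] [InnerProductSpace ℂ H]

/-- `ker (A - μ)ᵏ` for an unbounded operator `A`: a vector `f` lies in `ker (A - μ)ᵏ⁺¹` exactly if
`f ∈ dom A` and `(A - μ) f ∈ ker (A - μ)ᵏ`. -/
def kerPow (A : H →ₗ.[ℂ] H) (μ : ℂ) : ℕ → Submodule ℂ H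
  | 0 => ⊥
  | k + 1 => ((kerPow A μ k).comap (A.toFun - μ • A.domain.subtype)).map A.domain.subtype

theorem mem_kerPow_succ (A : H →ₗ.[ℂ] H) (μ : ℂ) (k : ℕ) (f : H) :
    f ∈ kerPow A μ (k + 1) ↔ ∃ hf : f ∈ A.domain, A ⟨f, hf⟩ - μ • f ∈ kerPow A μ k := by
  constructor
  · rintro ⟨x, hx, rfl⟩
    exact ⟨x.2, hx⟩
  · rintro ⟨hf, h⟩
    exact ⟨⟨f, hf⟩, h, rfl⟩

theorem kerPow_mono (A : H →ₗ.[ℂ] H) (μ : ℂ) : Monotone (kerPow A μ) := by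
  refine monotone_nat_of_le_succ fun k => ?_
  induction k with
  | zero => exact bot_le
  | succ k ih => exact Submodule.map_mono (Submodule.comap_mono ih)

/-- The root space `R(μ, A)`: all `f` with `(A - μ)ᵏ f = 0` for some `k`. It is `{0}` if `μ` is not
an eigenvalue of `A`. -/
def rootSpace (A : H →ₗ.[ℂ] H) (μ : ℂ) : Submodule ℂ H where
  carrier := {f | ∃ k, f ∈ kerPow A μ k}
  zero_mem' := ⟨0, Submodule.zero_mem _⟩
  add_mem' := by
    rintro f g ⟨k, hk⟩ ⟨l, hl⟩
    exact ⟨max k l, Submodule.add_mem _ (kerPow_mono A μ (le_max_left k l) hk)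
      (kerPow_mono A μ (le_max_right k l) hl)⟩
  smul_mem' := by
    rintro c f ⟨k, hk⟩
    exact ⟨k, Submodule.smul_mem _ c hk⟩

/-- The sequence `f` is made up of bases of all the root spaces of `A`: each `f n` is attached to a
number `ev n` in such a way that, for every `μ`, the `f n` with `ev n = μ` form a basis of
`R(μ, A)`. -/
def IsRootSystem (A : H →ₗ.[ℂ] H) (f : ℤ → H) : Prop :=
  ∃ ev : ℤ → ℂ, ∀ μ : ℂ,
    LinearIndependent ℂ (fun n : {n : ℤ // ev n = μ} => f n) ∧
      Submodule.span ℂ (range fun n : {n : ℤ // ev n = μ} => f n) = rootSpace A μ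

/-- `f` is a Riesz basis: the image of an orthonormal basis under a bounded and boundedly invertible
operator. -/
def IsRieszBasis (f : ℤ → H) : Prop :=
  ∃ (S : H ≃L[ℂ] H) (ψ : HilbertBasis ℤ ℂ H), ∀ n, f n = S (ψ n)

/-- The norms of the `f n` are bounded and bounded away from zero. -/
def IsSeminormalized (f : ℤ → H) : Prop :=
  ∃ c C : ℝ, 0 < c ∧ ∀ n, c ≤ ‖f n‖ ∧ ‖f n‖ ≤ C

/-- The root vectors of `A` form a Riesz basis: normalized bases of all the root spaces of `A` can
be put together to a sequence indexed by `ℤ`, and every such sequence (with any choice of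
bases whose norms are bounded and bounded away from zero) is a Riesz basis. -/
def RootVectorsFormRieszBasis (A : H →ₗ.[ℂ] H) : Prop :=
  (∃ f : ℤ → H, IsRootSystem A f ∧ ∀ n, ‖f n‖ = 1) ∧
    ∀ f : ℤ → H, IsRootSystem A f → IsSeminormalized f → IsRieszBasis f

end General

end NonlocalMomentum

end

noncomputable section

open MeasureTheory Set
open scoped ContDiff

namespace NonlocalMomentum

/-! ### Perturbations of orthonormal bases. -/

section Abstract

variable {H : Type*} [NormedAddCommGroup H] [InnerProductSpace ℂ H]

/-! In the orthonormal basis `exp(-ikx)/√(2π)` the periodic operator `i d/dx` is multiplication by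
`k`, and `f(2π) = s/√(2π)` with `s = ∑ fₖ`. So `P_{1,K}` becomes `f ↦ (k fₖ + s bₖ)ₖ` with `b =
K/√(2π)`: a diagonal operator plus an unbounded functional times a fixed vector
(`isDiagonalPlusSum_momentumOp`). Only the square summability of `b` is used from then on.

Away from the integers, eigenvalues solve `∑ bₖ/(z - k) = 1`. Splitting off the term `k = n` gives
`(z - n)(1 - σₙ(z)) = bₙ`, where near `n` the function `σₙ` and its Lipschitz constant are
controlled by `∑ |bₖ|/|n - k|`. This tends to zero (`tendsto_tsum_mul_invDist`), so for almost all
`n` a contraction yields a solution near `n` (`eventually_exists_eigenvalue`). The eigenvectors of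
the operator and of its adjoint are explicit. Their squared distances to `eₙ` are bounded by
multiples of `∑ₖ |bₖ|²/|n - k|²` and of `|bₙ|²`, both summable over `n` (`exists_eigenvector`,
`exists_adjoint_eigenvector`).

The rest is abstract. For a bounded resolvent `R`, the vectors orthogonal to almost all left
eigenvectors form a finite dimensional invariant subspace. Bases of its generalized eigenspaces
complete the remaining eigenvectors to a Riesz basis (`exists_rieszBasis_of_tsum_lt`). The root
spaces of the operator are the generalized eigenspaces of `R` (`IsResolvent.rootSpace_eq`). Any
other seminormalized choice of bases differs by a permutation, bounded scalars and a change inside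
finitely many vectors, hence is again a Riesz basis (`rootVectorsFormRieszBasis_of_isRieszBasis`).
-/

theorem hilbertBasis_ext {G : Type*} [NormedAddCommGroup G] [NormedSpace ℂ G]
    (e : HilbertBasis ℤ ℂ H) {S T : H →L[ℂ] G}
    (h : ∀ n, S (e n) = T (e n)) : S = T := by
  refine ContinuousLinearMap.ext_on (s := range e) ?_ ?_
  · rw [Submodule.dense_iff_topologicalClosure_eq_top]
    exact e.dense_span
  · rintro _ ⟨n, rfl⟩
    exact h n

theorem hilbertBasis_inner (e : HilbertBasis ℤ ℂ H) (m n : ℤ) :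
    inner ℂ (e m) (e n) = if m = n then 1 else 0 :=
  orthonormal_iff_ite.1 e.orthonormal m n

theorem hilbertBasis_eq_zero (e : HilbertBasis ℤ ℂ H) {x : H} (h : ∀ n, inner ℂ (e n) x = 0) :
    x = 0 := by
  refine e.repr.injective ?_
  ext n
  simp [e.repr_apply_apply, h n]

/-- Finite dimension makes `W` closed, so its preimage is a closed subspace containing a total set.
-/
theorem mem_of_hilbertBasis_mem (e : HilbertBasis ℤ ℂ H) (T : H →L[ℂ] H) (W : Submodule ℂ H)
    [FiniteDimensional ℂ W] (h : ∀ n, T (e n) ∈ W) (x : H) : T x ∈ W := by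
  have hc : IsClosed ((W.comap (T : H →ₗ[ℂ] H) : Submodule ℂ H) : Set H) :=
    (Submodule.closed_of_finiteDimensional W).preimage T.continuous
  have : (⊤ : Submodule ℂ H) ≤ W.comap (T : H →ₗ[ℂ] H) := by
    rw [← e.dense_span]
    refine Submodule.topologicalClosure_minimal _ (Submodule.span_le.2 ?_) hc
    rintro _ ⟨n, rfl⟩
    exact h n
  exact this trivial

/-- A vector family with square summable norms defines a Hilbert-Schmidt operator. -/
theorem exists_hilbertSchmidt [CompleteSpace H] (e : HilbertBasis ℤ ℂ H) {v : ℤ → H}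
    (hv : Summable fun n => ‖v n‖ ^ 2) :
    ∃ T : H →L[ℂ] H, (∀ n, T (e n) = v n) ∧ ‖T‖ ≤ Real.sqrt (∑' n, ‖v n‖ ^ 2) := by
  have hm : Memℓp v 2 := by
    rw [memℓp_gen_iff (by norm_num)]
    simpa using hv
  let V : lp (fun _ : ℤ => H) 2 := ⟨v, hm⟩
  let B : ℤ → H →L[ℂ] ℂ →L[ℂ] H := fun _ =>
    (ContinuousLinearMap.lsmul ℂ ℂ : ℂ →L[ℂ] H →L[ℂ] H).flip
  have hB : ∀ i, ‖B i‖ ≤ (1 : NNReal) := fun i => by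
    simp only [B, ContinuousLinearMap.opNorm_flip, NNReal.coe_one]
    exact ContinuousLinearMap.opNorm_lsmul_le
  let D := lp.dualPairing 2 2 B hB V
  have hD : ‖D‖ ≤ ‖V‖ := by
    have := (lp.dualPairing 2 2 B hB).le_of_opNorm_le (lp.norm_dualPairing B hB) V
    simpa using this
  have hV : ‖V‖ = Real.sqrt (∑' n, ‖v n‖ ^ 2) := by
    rw [lp.norm_eq_tsum_rpow (by norm_num)]
    simp [V, Real.sqrt_eq_rpow]
  refine ⟨D.comp (e.repr.toContinuousLinearEquiv : H →L[ℂ] lp (fun _ : ℤ => ℂ) 2), fun n => ?_, ?_⟩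
  · have : D (e.repr (e n)) = ∑' i, B i (V i) (e.repr (e n) i) := lp.dualPairing_apply B hB V _
    change D (e.repr (e n)) = _
    rw [this, tsum_eq_single n]
    · simp [B, V, e.repr_apply_apply, e.orthonormal.1 n]
    · intro m hm
      simp [B, e.repr_apply_apply, hilbertBasis_inner, hm]
  · refine ContinuousLinearMap.opNorm_le_bound _ (Real.sqrt_nonneg _) fun x => ?_
    rw [← hV]
    calc ‖D (e.repr x)‖ ≤ ‖D‖ * ‖e.repr x‖ := D.le_opNorm _
      _ ≤ ‖V‖ * ‖x‖ := by
        rw [e.repr.norm_map]; gcongr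

/-- Bounded multipliers with respect to an orthonormal basis. -/
theorem exists_diagonal (e : HilbertBasis ℤ ℂ H) {c : ℤ → ℂ} {C : ℝ}
    (hc : ∀ n, ‖c n‖ ≤ C) :
    ∃ T : H →L[ℂ] H, (∀ n, T (e n) = c n • e n) ∧
      ∀ n x, inner ℂ (e n) (T x) = c n * inner ℂ (e n) x := by
  have hC : 0 ≤ C := (norm_nonneg _).trans (hc 0)
  let M : lp (fun _ : ℤ => ℂ) 2 →L[ℂ] lp (fun _ : ℤ => ℂ) 2 :=
    lp.mapCLM 2 (fun n => c n • ContinuousLinearMap.id ℂ ℂ) hC (fun n => by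
      refine (norm_smul_le _ _).trans ?_
      simpa using hc n)
  let E := e.repr.toContinuousLinearEquiv
  have key : ∀ n x, inner ℂ (e n) (e.repr.symm (M (e.repr x))) = c n * inner ℂ (e n) x := by
    intro n x
    rw [← e.repr_apply_apply, ← e.repr_apply_apply, LinearIsometryEquiv.apply_symm_apply]
    rfl
  refine ⟨(E.symm : lp (fun _ : ℤ => ℂ) 2 →L[ℂ] H).comp (M.comp (E : H →L[ℂ] lp (fun _ : ℤ => ℂ) 2)), fun n => ?_, key⟩
  rw [← sub_eq_zero]
  refine hilbertBasis_eq_zero e fun m => ?_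
  have h1 := key m (e n)
  have h2 := hilbertBasis_inner e m n
  rw [inner_sub_right, inner_smul_right]
  erw [h1]
  rw [h2]
  split_ifs with h
  · rw [h]; simp
  · simp

theorem exists_diagonal_equiv (e : HilbertBasis ℤ ℂ H) {c : ℤ → ℂ} {a C : ℝ} (ha : 0 < a)
    (hc : ∀ n, a ≤ ‖c n‖ ∧ ‖c n‖ ≤ C) :
    ∃ T : H ≃L[ℂ] H, ∀ n, T (e n) = c n • e n := by
  have h0 : ∀ n, c n ≠ 0 := fun n => norm_pos_iff.1 (ha.trans_le (hc n).1)
  obtain ⟨T, hT, -⟩ := exists_diagonal e fun n => (hc n).2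
  obtain ⟨S, hS, -⟩ := exists_diagonal e (c := fun n => (c n)⁻¹) (C := a⁻¹) fun n => by
    rw [norm_inv]; exact inv_anti₀ ha (hc n).1
  have h1 : S.comp T = ContinuousLinearMap.id ℂ H :=
    hilbertBasis_ext e fun n => by simp [hT, hS, h0 n]
  have h2 : T.comp S = ContinuousLinearMap.id ℂ H :=
    hilbertBasis_ext e fun n => by simp [hT, hS, h0 n]
  exact ⟨ContinuousLinearEquiv.equivOfInverse T S (fun x => DFunLike.congr_fun h1 x)
    (fun x => DFunLike.congr_fun h2 x), hT⟩

/-- A perturbation of a bijection with values in a finite dimensional space is injective if and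
only if it is surjective. -/
theorem injective_iff_surjective_of_sub_mem {T : H →ₗ[ℂ] H} {A : H ≃ₗ[ℂ] H}
    {W : Submodule ℂ H} [FiniteDimensional ℂ W] (h : ∀ x, T x - A x ∈ W) :
    Function.Injective T ↔ Function.Surjective T := by
  -- `U = A⁻¹T` is the identity modulo `W'`, so its kernel lies in `W'` and its range fills
  -- everything modulo `W'`. Both properties are thus decided on the finite dimensional space `W'`.
  let W' : Submodule ℂ H := W.map (A.symm : H →ₗ[ℂ] H)
  let U : H →ₗ[ℂ] H := (A.symm : H →ₗ[ℂ] H) ∘ₗ T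
  have hU : ∀ x, U x - x ∈ W' := fun x => ⟨T x - A x, h x, by simp [U]⟩
  have hmaps : ∀ x ∈ W', U x ∈ W' := fun x hx => by
    simpa using W'.add_mem (hU x) hx
  have e1 : Function.Injective T ↔ Function.Injective (U.restrict hmaps) := by
    have : Function.Injective T ↔ Function.Injective U :=
      (Function.Injective.of_comp_iff A.symm.injective T).symm
    rw [this]
    constructor
    · intro hi x y hxy
      exact Subtype.ext (hi (congrArg Subtype.val hxy))
    · intro hi
      rw [injective_iff_map_eq_zero] at hi ⊢
      intro x hx
      have hx' : x ∈ W' := by simpa [hx] using W'.neg_mem (hU x)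
      exact congrArg Subtype.val (hi ⟨x, hx'⟩ (Subtype.ext hx))
  have e2 : Function.Surjective T ↔ Function.Surjective (U.restrict hmaps) := by
    have : Function.Surjective T ↔ Function.Surjective U :=
      (Function.Surjective.of_comp_iff' A.symm.bijective T).symm
    rw [this]
    constructor
    · rintro hs ⟨w, hw⟩
      obtain ⟨x, rfl⟩ := hs w
      have hx : x ∈ W' := by simpa using W'.sub_mem hw (hU x)
      exact ⟨⟨x, hx⟩, rfl⟩
    · intro hs y
      obtain ⟨w, hw⟩ := hs ⟨U y - y, hU y⟩
      refine ⟨y - w, ?_⟩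
      have : U w = U y - y := congrArg Subtype.val hw
      rw [map_sub, this]
      abel
  rw [e1, e2, LinearMap.injective_iff_surjective]

/-- A bounded operator that differs from an isomorphism by an operator of finite rank is an
isomorphism as soon as it is injective. -/
theorem exists_equiv_of_injective [CompleteSpace H] (e : HilbertBasis ℤ ℂ H) {T : H →L[ℂ] H}
    {A : H ≃L[ℂ] H} {F : Finset ℤ} (h : ∀ n ∉ F, T (e n) = A (e n))
    (hT : Function.Injective T ∨ Function.Surjective T) : ∃ S : H ≃L[ℂ] H, ∀ x, S x = T x := by
  let W : Submodule ℂ H := Submodule.span ℂ ((fun n => T (e n) - A (e n)) '' (F : Set ℤ))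
  have : FiniteDimensional ℂ W := FiniteDimensional.span_of_finite ℂ (F.finite_toSet.image _)
  have hW : ∀ x, T x - A x ∈ W :=
    mem_of_hilbertBasis_mem e (T - A) W fun n => by
      by_cases hn : n ∈ F
      · exact Submodule.subset_span ⟨n, hn, rfl⟩
      · simp [h n hn]
  have key := injective_iff_surjective_of_sub_mem (T := (T : H →ₗ[ℂ] H)) (A := A.toLinearEquiv) hW
  have hi : Function.Injective T := hT.elim id key.2
  have hs : Function.Surjective T := hT.elim key.1 id
  exact ⟨ContinuousLinearEquiv.ofBijective T (LinearMap.ker_eq_bot.2 hi)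
    (LinearMap.range_eq_top.2 hs), fun x => rfl⟩

/-- Families close to an orthonormal basis are images of it under an isomorphism. -/
theorem exists_equiv_of_tsum_lt_one [CompleteSpace H] (e : HilbertBasis ℤ ℂ H) {v : ℤ → H}
    (hv : Summable fun n => ‖v n - e n‖ ^ 2) (h1 : ∑' n, ‖v n - e n‖ ^ 2 < 1) :
    ∃ S : H ≃L[ℂ] H, ∀ n, S (e n) = v n := by
  obtain ⟨T, hT, hn⟩ := exists_hilbertSchmidt e hv
  have hlt : ‖-T‖ < 1 := by
    rw [norm_neg]
    exact hn.trans_lt ((Real.sqrt_lt' one_pos).2 (by simpa using h1))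
  let u := Units.oneSub (-T) hlt
  refine ⟨ContinuousLinearEquiv.unitsEquiv ℂ H u, fun n => ?_⟩
  have : (u : H →L[ℂ] H) = 1 + T := by simp [u]
  change (u : H →L[ℂ] H) (e n) = v n
  rw [this]
  simp [hT]

end Abstract

/-! ### Riesz bases of generalized eigenvectors of a bounded operator. -/

/-- Every endomorphism of a finite dimensional complex vector space has a basis made up of bases of
its generalized eigenspaces. -/
theorem exists_basis_maxGenEigenspace {V J : Type*} [AddCommGroup V] [Module ℂ V]
    [FiniteDimensional ℂ V] (T : Module.End ℂ V) (b₀ : Module.Basis J ℂ V) :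
    ∃ (b : Module.Basis J ℂ V) (ev : J → ℂ), (∀ j, b j ∈ T.maxGenEigenspace (ev j)) ∧
      ∀ ν, ∀ x ∈ T.maxGenEigenspace ν, x ∈ Submodule.span ℂ (b '' {j | ev j = ν}) := by
  classical
  have hI := DirectSum.isInternal_submodule_of_iSupIndep_of_iSup_eq_top
    T.independent_maxGenEigenspace T.iSup_maxGenEigenspace_eq_top
  let v : ∀ ν : ℂ, Module.Basis _ ℂ (T.maxGenEigenspace ν) := fun ν => Module.finBasis ℂ _
  let B := hI.collectedBasis v
  let σ := B.indexEquiv b₀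
  have hB : ∀ a, B a = v a.1 a.2 := fun a => by
    simp only [B, DirectSum.IsInternal.collectedBasis_coe]
  refine ⟨B.reindex σ, fun j => (σ.symm j).1, fun j => ?_, fun ν x hx => ?_⟩
  · rw [Module.Basis.reindex_apply, hB]
    exact Subtype.mem _
  · have h1 := congrArg Subtype.val ((v ν).sum_repr ⟨x, hx⟩)
    simp only [AddSubmonoidClass.coe_finsetSum, SetLike.val_smul] at h1
    rw [← h1]
    refine Submodule.sum_mem _ fun i _ => Submodule.smul_mem _ _ (Submodule.subset_span ?_)
    exact ⟨σ ⟨ν, i⟩, by simp, by simp [hB]⟩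

section Abstract

variable {H : Type*} [NormedAddCommGroup H] [InnerProductSpace ℂ H]

/-- The vectors orthogonal to all `g n` with `n ∉ F`. -/
def annihilator (g : ℤ → H) (F : Finset ℤ) : Submodule ℂ H where
  carrier := {x | ∀ n ∉ F, inner ℂ (g n) x = 0}
  zero_mem' := fun n _ => inner_zero_right _
  add_mem' := fun hx hy n hn => by rw [inner_add_right, hx n hn, hy n hn, add_zero]
  smul_mem' := fun c x hx n hn => by rw [inner_smul_right, hx n hn, mul_zero]

/-- The adjoint of `S` carries this space onto the span of the `e n` with `n ∈ F`. Since `S` fixes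
these vectors, the isomorphism just reads off the coordinates in `F`. Indexing the basis by `F`
itself lets it fill the gaps of a family indexed by `ℤ`. -/
theorem nonempty_basis_annihilator [CompleteSpace H] (e : HilbertBasis ℤ ℂ H) (S : H ≃L[ℂ] H)
    {F : Finset ℤ} (hF : ∀ n ∈ F, S (e n) = e n) :
    Nonempty (Module.Basis F ℂ (annihilator (fun n => S (e n)) F)) := by
  let L : annihilator (fun n => S (e n)) F →ₗ[ℂ] (F → ℂ) :=
    { toFun := fun x n => inner ℂ (e n) (x : H)
      map_add' := fun x y => by ext n; simp
      map_smul' := fun c x => by ext n; simp }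
  have hL : Function.Bijective L := by
    constructor
    · rw [injective_iff_map_eq_zero]
      rintro ⟨x, hx⟩ h0
      refine Subtype.ext ?_
      have h1 : ∀ n, inner ℂ (S (e n)) x = 0 := fun n => by
        by_cases hn : n ∈ F
        · rw [hF n hn]; exact congrFun h0 ⟨n, hn⟩
        · exact hx n hn
      have h2 : ContinuousLinearMap.adjoint (S : H →L[ℂ] H) x = 0 :=
        hilbertBasis_eq_zero e fun n => by
          rw [ContinuousLinearMap.adjoint_inner_right]; exact h1 n
      have h3 : inner ℂ (S (S.symm x)) x = 0 := by
        have := ContinuousLinearMap.adjoint_inner_right (S : H →L[ℂ] H) (S.symm x) x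
        rw [h2, inner_zero_right] at this
        exact this.symm
      simpa using h3
    · intro y
      let z : H := ∑ m : F, y m • e m
      let x : H := ContinuousLinearMap.adjoint (S.symm : H →L[ℂ] H) z
      have hx : ∀ n, inner ℂ (S (e n)) x = inner ℂ (e n) z := fun n => by
        simp [x, ContinuousLinearMap.adjoint_inner_right]
      have hz : ∀ n, inner ℂ (e n) z = ∑ m : F, if n = m then y m else 0 := fun n => by
        simp only [z, inner_sum, inner_smul_right, hilbertBasis_inner, mul_ite, mul_one, mul_zero]
      refine ⟨⟨x, fun n hn => ?_⟩, ?_⟩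
      · rw [hx, hz]
        refine Finset.sum_eq_zero fun m _ => if_neg ?_
        rintro rfl
        exact hn m.2
      · ext n
        change inner ℂ (e n) x = y n
        rw [← hF n n.2, hx, hz]
        simp [Subtype.ext_iff.symm]
  exact ⟨Module.Basis.ofEquivFun (LinearEquiv.ofBijective L hL)⟩

/-- A left eigenvector for `r` turns `(R - ν)ᵏ` into multiplication by `(r - ν)ᵏ`, which is not
zero. -/
theorem inner_eq_zero_of_mem_maxGenEigenspace {R : H →L[ℂ] H} {g : H} {r ν : ℂ}
    (hg : ∀ x, inner ℂ g (R x) = r * inner ℂ g x) (hr : r ≠ ν) {x : H}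
    (hx : x ∈ Module.End.maxGenEigenspace (R : H →ₗ[ℂ] H) ν) : inner ℂ g x = 0 := by
  obtain ⟨k, hk⟩ := (Module.End.mem_maxGenEigenspace _ _ _).1 hx
  have key : ∀ (k : ℕ) (x : H), inner ℂ g ((((R : H →ₗ[ℂ] H) - ν • 1) ^ k) x)
      = (r - ν) ^ k * inner ℂ g x := by
    intro k
    induction k with
    | zero => simp
    | succ k ih =>
      intro x
      rw [pow_succ, Module.End.mul_apply, ih, pow_succ]
      simp only [LinearMap.sub_apply, ContinuousLinearMap.coe_coe, LinearMap.smul_apply,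
        Module.End.one_apply, inner_sub_right, inner_smul_right, hg]
      ring
  have := key k x
  rw [hk, inner_zero_right] at this
  exact (mul_eq_zero.1 this.symm).resolve_left (pow_ne_zero _ (sub_ne_zero.2 hr))

/-- Outside `F` the `f n` and `g n` are biorthogonal up to nonzero factors. The common kernel `V` of
the `g n` with `n ∉ F` is invariant under `R` and has a basis indexed by `F`; generalized
eigenvectors chosen in `V` replace the `f n` with `n ∈ F`. -/
theorem exists_rieszBasis_of_tsum_lt [CompleteSpace H] (e : HilbertBasis ℤ ℂ H) (R : H →L[ℂ] H)
    {F : Finset ℤ} {f g : ℤ → H} {r : ℤ → ℂ}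
    (hf : ∀ n ∉ F, R (f n) = r n • f n)
    (hg : ∀ n ∉ F, ∀ x, inner ℂ (g n) (R x) = r n * inner ℂ (g n) x)
    (hr : InjOn r {n | n ∉ F}) (hgF : ∀ n ∈ F, g n = e n)
    (hfs : Summable fun n => ‖f n - e n‖ ^ 2) (hgs : Summable fun n => ‖g n - e n‖ ^ 2)
    (hf9 : ∑' n, ‖f n - e n‖ ^ 2 < 1 / 9) (hg9 : ∑' n, ‖g n - e n‖ ^ 2 < 1 / 9) :
    ∃ (φ : ℤ → H) (ev : ℤ → ℂ), IsRieszBasis φ ∧ {n | ∃ m ≠ n, ev m = ev n}.Finite ∧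
      ∀ ν, Submodule.span ℂ (φ '' {n | ev n = ν})
        = Module.End.maxGenEigenspace (R : H →ₗ[ℂ] H) ν := by
  classical
  obtain ⟨Sf, hSf⟩ := exists_equiv_of_tsum_lt_one e hfs (by linarith)
  obtain ⟨Sg, hSg⟩ := exists_equiv_of_tsum_lt_one e hgs (by linarith)
  have hsmall : ∀ {v : ℤ → H}, (Summable fun n => ‖v n - e n‖ ^ 2) →
      ∑' n, ‖v n - e n‖ ^ 2 < 1 / 9 → ∀ n, ‖v n - e n‖ < 1 / 3 := by
    intro v h1 h2 n
    have := h1.le_tsum n fun _ _ => by positivity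
    refine lt_of_pow_lt_pow_left₀ 2 (by norm_num) ?_
    linarith
  have hfg : ∀ n, inner ℂ (g n) (f n) ≠ 0 := by
    intro n h0
    have hn := e.orthonormal.1 n
    -- The bound `1/9` serves here: both distances are below `1/3`, so orthogonality would give `1 ≤
    -- 1/3 + 4/3 · 1/3 = 7/9`.
    have e1 : (1 : ℂ) = - (inner ℂ (g n - e n) (e n) + inner ℂ (g n) (f n - e n)) := by
      rw [inner_sub_left, inner_sub_right, h0, hilbertBasis_inner, if_pos rfl]
      ring
    have e2 := congrArg norm e1
    rw [norm_one, norm_neg] at e2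
    have e3 := norm_add_le (inner ℂ (g n - e n) (e n) : ℂ) (inner ℂ (g n) (f n - e n))
    have e4 := norm_inner_le_norm (𝕜 := ℂ) (g n - e n) (e n)
    have e5 := norm_inner_le_norm (𝕜 := ℂ) (g n) (f n - e n)
    have e6 := hsmall hfs hf9 n
    have e7 := hsmall hgs hg9 n
    have e8 : ‖g n‖ ≤ ‖g n - e n‖ + ‖e n‖ := by simpa using norm_add_le (g n - e n) (e n)
    rw [hn] at e4 e8
    have e9 : ‖g n‖ * ‖f n - e n‖ ≤ 4 / 3 * (1 / 3) :=
      mul_le_mul (by linarith) e6.le (norm_nonneg _) (by norm_num)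
    linarith
  have horth : ∀ n ∉ F, ∀ m ∉ F, n ≠ m → inner ℂ (g n) (f m) = 0 := by
    intro n hn m hm hnm
    have h1 := hg n hn (f m)
    rw [hf m hm, inner_smul_right] at h1
    have h2 : (r m - r n) * inner ℂ (g n) (f m) = 0 := by rw [sub_mul, h1, sub_self]
    exact (mul_eq_zero.1 h2).resolve_left (sub_ne_zero.2 fun h => hnm (hr hn hm h.symm))
  have hgS : (fun n => Sg (e n)) = g := funext hSg
  obtain ⟨b₀⟩ := nonempty_basis_annihilator e Sg (F := F) fun n hn => by rw [hSg, hgF n hn]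
  rw [hgS] at b₀
  set V := annihilator g F with hVdef
  have hVR : ∀ x ∈ V, (R : H →ₗ[ℂ] H) x ∈ V := fun x hx n hn => by
    rw [ContinuousLinearMap.coe_coe, hg n hn, hx n hn, mul_zero]
  have : FiniteDimensional ℂ V := b₀.finiteDimensional_of_finite
  obtain ⟨b, evV, hb1, hb2⟩ :=
    exists_basis_maxGenEigenspace ((R : H →ₗ[ℂ] H).restrict hVR) b₀
  have hres : ∀ (ν : ℂ) (x : V), x ∈ Module.End.maxGenEigenspace ((R : H →ₗ[ℂ] H).restrict hVR) ν ↔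
      (x : H) ∈ Module.End.maxGenEigenspace (R : H →ₗ[ℂ] H) ν := by
    intro ν x
    rw [Module.End.maxGenEigenspace, Module.End.genEigenspace_restrict]
    rfl
  let φ : ℤ → H := fun n => if h : n ∈ F then (b ⟨n, h⟩ : H) else f n
  let ev : ℤ → ℂ := fun n => if h : n ∈ F then evV ⟨n, h⟩ else r n
  have hφF : ∀ n (h : n ∈ F), φ n = b ⟨n, h⟩ := fun n h => dif_pos h
  have hφ : ∀ n ∉ F, φ n = f n := fun n h => dif_neg h
  have hevF : ∀ n (h : n ∈ F), ev n = evV ⟨n, h⟩ := fun n h => dif_pos h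
  have hev : ∀ n ∉ F, ev n = r n := fun n h => dif_neg h
  have hφs : Summable fun n => ‖φ n - e n‖ ^ 2 := by
    refine (summable_congr_cofinite ?_).1 hfs
    filter_upwards [F.finite_toSet.compl_mem_cofinite] with n hn
    rw [hφ n hn]
  obtain ⟨T₀, hT₀, -⟩ := exists_hilbertSchmidt e hφs
  let T : H →L[ℂ] H := 1 + T₀
  have hT : ∀ n, T (e n) = φ n := fun n => by simp [T, hT₀]
  have hTinj : Function.Injective T := by
    rw [injective_iff_map_eq_zero]
    intro x hx
    have h1 : ∀ n ∉ F, inner ℂ (e n) x = 0 := by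
      intro n hn
      -- By biorthogonality, pairing `T x` with `g n` sees only the `n`-th coordinate of `x`. A
      -- kernel vector therefore has coordinates in `F` only, where the basis of `V` is independent.
      have h2 : (innerSL ℂ (g n)).comp T
          = (inner ℂ (g n) (f n) : ℂ) • innerSL ℂ (e n) := by
        refine hilbertBasis_ext e fun m => ?_
        simp only [ContinuousLinearMap.comp_apply, hT, innerSL_apply_apply,
          smul_apply, hilbertBasis_inner, smul_eq_mul, mul_ite, mul_one,
          mul_zero]
        by_cases hm : m ∈ F
        · rw [if_neg (by rintro rfl; exact hn hm), hφF m hm]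
          exact (b ⟨m, hm⟩).2 n hn
        · rw [hφ m hm]
          split_ifs with hnm
          · rw [hnm]
          · exact horth n hn m hm hnm
      have h3 := DFunLike.congr_fun h2 x
      simp only [ContinuousLinearMap.comp_apply, hx, map_zero, smul_apply,
        innerSL_apply_apply, smul_eq_mul] at h3
      exact (mul_eq_zero.1 h3.symm).resolve_left (hfg n)
    have h2 : x = ∑ m : F, (inner ℂ (e m) x : ℂ) • e m := by
      rw [← sub_eq_zero]
      refine hilbertBasis_eq_zero e fun n => ?_
      simp only [inner_sub_right, inner_sum, inner_smul_right, hilbertBasis_inner, mul_ite,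
        mul_one, mul_zero]
      by_cases hn : n ∈ F
      · rw [Finset.sum_eq_single (⟨n, hn⟩ : F)]
        · simp
        · intro m _ hm
          exact if_neg fun h => hm (Subtype.ext h.symm)
        · simp
      · rw [h1 n hn, Finset.sum_eq_zero, sub_zero]
        intro m _
        refine if_neg ?_
        rintro rfl
        exact hn m.2
    have h3 : ∑ m : F, (inner ℂ (e m) x : ℂ) • b m = 0 := by
      refine Subtype.ext ?_
      have h4 := congrArg T h2
      rw [hx, map_sum] at h4
      simp only [map_smul, hT] at h4
      simp only [AddSubmonoidClass.coe_finsetSum, SetLike.val_smul, ZeroMemClass.coe_zero]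
      rw [h4]
      exact Finset.sum_congr rfl fun m _ => by rw [hφF m m.2]
    have h4 := Fintype.linearIndependent_iff.1 b.linearIndependent _ h3
    rw [h2]
    exact Finset.sum_eq_zero fun m _ => by rw [h4 m, zero_smul]
  obtain ⟨S, hS⟩ := exists_equiv_of_injective e (T := T) (A := Sf) (F := F)
    (fun n hn => by rw [hT, hφ n hn, hSf]) (Or.inl hTinj)
  refine ⟨φ, ev, ⟨S, e, fun n => by rw [hS, hT]⟩, ?_, fun ν => le_antisymm ?_ ?_⟩
  · have h1 : {n | n ∉ F ∧ r n ∈ ev '' F}.Finite := by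
      have : InjOn r {n | n ∉ F ∧ r n ∈ ev '' F} := hr.mono fun n hn => hn.1
      refine Finite.of_finite_image ((F.finite_toSet.image ev).subset ?_) this
      rintro _ ⟨n, hn, rfl⟩
      exact hn.2
    refine (F.finite_toSet.union h1).subset ?_
    rintro n ⟨m, hmn, hm⟩
    by_cases hn : n ∈ F
    · exact Or.inl hn
    · refine Or.inr ⟨hn, ?_⟩
      rw [hev n hn] at hm
      by_cases hm' : m ∈ F
      · exact ⟨m, hm', hm⟩
      · rw [hev m hm'] at hm
        exact absurd (hr hm' hn hm) hmn
  · rw [Submodule.span_le]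
    rintro _ ⟨n, rfl, rfl⟩
    by_cases hn : n ∈ F
    · simp only [hφF n hn, hevF n hn]
      exact (hres _ _).1 (hb1 _)
    · simp only [hφ n hn, hev n hn]
      exact Module.End.eigenspace_le_maxGenEigenspace (Module.End.mem_eigenspace_iff.2 (hf n hn))
  · intro x hx
    have hmemV : ∀ y ∈ V, y ∈ Module.End.maxGenEigenspace (R : H →ₗ[ℂ] H) ν →
        y ∈ Submodule.span ℂ (φ '' {n | ev n = ν}) := by
      intro y hyV hy
      have h1 := Submodule.mem_map_of_mem (f := V.subtype) (hb2 ν ⟨y, hyV⟩ ((hres _ _).2 hy))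
      rw [Submodule.map_span] at h1
      refine Submodule.span_mono ?_ h1
      rintro _ ⟨_, ⟨j, hj, rfl⟩, rfl⟩
      exact ⟨j, (hevF j j.2).trans hj, hφF j j.2⟩
    by_cases hν : ∃ n ∉ F, r n = ν
    · obtain ⟨n, hn, hrn⟩ := hν
      have hfn : f n ∈ Module.End.maxGenEigenspace (R : H →ₗ[ℂ] H) ν :=
        Module.End.eigenspace_le_maxGenEigenspace
          (Module.End.mem_eigenspace_iff.2 (hrn ▸ hf n hn))
      have hfn' : f n ∈ Submodule.span ℂ (φ '' {n | ev n = ν}) :=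
        Submodule.subset_span ⟨n, (hev n hn).trans hrn, hφ n hn⟩
      -- Removing the `f n` component leaves a vector killed by `g n`; the other `g m` kill it
      -- because their eigenvalues differ from `ν`.
      let c : ℂ := inner ℂ (g n) x / inner ℂ (g n) (f n)
      have h1 : x - c • f n ∈ Module.End.maxGenEigenspace (R : H →ₗ[ℂ] H) ν :=
        Submodule.sub_mem _ hx (Submodule.smul_mem _ _ hfn)
      have h2 : x - c • f n ∈ V := by
        intro m hm
        by_cases hmn : m = n
        · rw [hmn, inner_sub_right, inner_smul_right, div_mul_cancel₀ _ (hfg n), sub_self]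
        · exact inner_eq_zero_of_mem_maxGenEigenspace (hg m hm)
            (fun h => hmn (hr hm hn (h.trans hrn.symm))) h1
      have h3 := Submodule.add_mem _ (hmemV _ h2 h1) (Submodule.smul_mem _ c hfn')
      simpa using h3
    · push Not at hν
      exact hmemV x (fun n hn => inner_eq_zero_of_mem_maxGenEigenspace (hg n hn) (hν n hn) hx) hx

theorem exists_finset_tsum_lt {a : ℤ → ℝ} {ε : ℝ} (hε : 0 < ε) :
    ∀ᶠ s : Finset ℤ in Filter.atTop, ∑' n, (if n ∈ s then 0 else a n) < ε := by
  filter_upwards [(tendsto_tsum_compl_atTop_zero a).eventually_lt_const hε] with s hs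
  rw [show (fun n => if n ∈ s then 0 else a n) = ({n | n ∉ s} : Set ℤ).indicator a by
    ext n; by_cases h : n ∈ s <;> simp [h], ← tsum_subtype]
  exact hs

/-- If a bounded operator and its adjoint have eigenvectors that are quadratically close to an
orthonormal basis, up to finitely many indices and with simple eigenvalues, then there is a Riesz
basis made up of generalized eigenvectors. -/
theorem exists_rieszBasis_maxGenEigenspace [CompleteSpace H] (e : HilbertBasis ℤ ℂ H)
    (R : H →L[ℂ] H) {F : Finset ℤ} {f g : ℤ → H} {r : ℤ → ℂ}
    (hf : ∀ n ∉ F, R (f n) = r n • f n)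
    (hg : ∀ n ∉ F, ∀ x, inner ℂ (g n) (R x) = r n * inner ℂ (g n) x)
    (hr : InjOn r {n | n ∉ F})
    (hfs : Summable fun n => ‖f n - e n‖ ^ 2) (hgs : Summable fun n => ‖g n - e n‖ ^ 2) :
    ∃ (φ : ℤ → H) (ev : ℤ → ℂ), IsRieszBasis φ ∧ {n | ∃ m ≠ n, ev m = ev n}.Finite ∧
      ∀ ν, Submodule.span ℂ (φ '' {n | ev n = ν})
        = Module.End.maxGenEigenspace (R : H →ₗ[ℂ] H) ν := by
  classical
  -- Enlarging the exceptional set makes both tails small; inside it the two families may be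
  -- replaced by `e`.
  obtain ⟨F', hF', h1, h2⟩ := ((Filter.eventually_ge_atTop F).and
    ((exists_finset_tsum_lt (a := fun n => ‖f n - e n‖ ^ 2) (ε := 1 / 9) (by norm_num)).and
    (exists_finset_tsum_lt (a := fun n => ‖g n - e n‖ ^ 2) (ε := 1 / 9) (by norm_num)))).exists
  have hout : ∀ n ∉ F', n ∉ F := fun n hn h => hn (hF' h)
  have key : ∀ v : ℤ → H, (fun n => ‖(if n ∈ F' then e n else v n) - e n‖ ^ 2)
      = fun n => if n ∈ F' then 0 else ‖v n - e n‖ ^ 2 := fun v => by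
    ext n; split_ifs <;> simp
  have hs : ∀ v : ℤ → H, (Summable fun n => ‖v n - e n‖ ^ 2) →
      Summable fun n => if n ∈ F' then 0 else ‖v n - e n‖ ^ 2 := fun v hv => by
    refine (summable_congr_cofinite ?_).1 hv
    filter_upwards [F'.finite_toSet.compl_mem_cofinite] with n hn
    exact (if_neg hn).symm
  refine exists_rieszBasis_of_tsum_lt e R (F := F')
    (f := fun n => if n ∈ F' then e n else f n) (g := fun n => if n ∈ F' then e n else g n) (r := r)
    (fun n hn => ?_) (fun n hn x => ?_) (hr.mono hout)
    (fun n hn => if_pos hn) ?_ ?_ ?_ ?_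
  · simp only [if_neg hn, hf n (hout n hn)]
  · simp only [if_neg hn, hg n (hout n hn)]
  · rw [key]; exact hs f hfs
  · rw [key]; exact hs g hgs
  · rw [key]; exact h1
  · rw [key]; exact h2

end Abstract

/-! ### Resolvents, root spaces and independence of the choice of root vectors. -/

section Abstract

variable {H : Type*} [NormedAddCommGroup H] [InnerProductSpace ℂ H]

/-- `R` is the resolvent `(A - μ₀)⁻¹`. -/
def IsResolvent (A : H →ₗ.[ℂ] H) (μ₀ : ℂ) (R : H →L[ℂ] H) : Prop :=
  ∀ f h, (f, h) ∈ A.graph ↔ R (h - μ₀ • f) = f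

theorem IsResolvent.injective {A : H →ₗ.[ℂ] H} {μ₀ : ℂ} {R : H →L[ℂ] H}
    (hR : IsResolvent A μ₀ R) : Function.Injective R := by
  rw [injective_iff_map_eq_zero]
  intro x hx
  exact A.graph_fst_eq_zero_snd ((hR 0 x).2 (by simpa using hx)) rfl

/-- The graph of `A` consists of the pairs `(R x, x + μ₀ R x)`, so the adjoint relation can be
tested on all vectors `x`. -/
theorem IsResolvent.adjoint [CompleteSpace H] {A : H →ₗ.[ℂ] H} {μ₀ : ℂ} {R : H →L[ℂ] H}
    (hR : IsResolvent A μ₀ R) (hA : Dense (A.domain : Set H)) :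
    IsResolvent A.adjoint (starRingEnd ℂ μ₀) (ContinuousLinearMap.adjoint R) := by
  intro u w
  rw [LinearPMap.adjoint_graph_eq_graph_adjoint hA, Submodule.mem_adjoint_iff]
  have key : ∀ x, inner ℂ (x + μ₀ • R x) u - inner ℂ (R x) w
      = inner ℂ x (u - ContinuousLinearMap.adjoint R (w - starRingEnd ℂ μ₀ • u)) := by
    intro x
    rw [inner_sub_right, ContinuousLinearMap.adjoint_inner_right, inner_add_left, inner_sub_right,
      inner_smul_left, inner_smul_right]
    ring
  constructor
  · intro h
    have h1 : ∀ x, inner ℂ x (u - ContinuousLinearMap.adjoint R (w - starRingEnd ℂ μ₀ • u)) = 0 := by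
      intro x
      rw [← key]
      exact h _ _ ((hR _ _).2 (by simp))
    exact (sub_eq_zero.1 (inner_self_eq_zero.1 (h1 _))).symm
  · intro h a b hab
    have h1 := (hR _ _).1 hab
    have h2 := key (b - μ₀ • a)
    rw [h1, h, sub_self, inner_zero_right, sub_add_cancel] at h2
    exact h2

theorem IsResolvent.mem_domain_iff {A : H →ₗ.[ℂ] H} {μ₀ : ℂ} {R : H →L[ℂ] H}
    (hR : IsResolvent A μ₀ R) (f : H) : f ∈ A.domain ↔ ∃ x, R x = f := by
  constructor
  · intro hf
    exact ⟨_, (hR _ _).1 (A.mem_graph ⟨f, hf⟩)⟩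
  · rintro ⟨x, rfl⟩
    exact LinearPMap.mem_domain_of_mem_graph ((hR (R x) (x + μ₀ • R x)).2 (by simp))

/-- On the domain, `R - (μ - μ₀)⁻¹ = -(μ - μ₀)⁻¹ R (A - μ)`, and `R` is injective and commutes with
the left side. For `μ = μ₀` the inverse has the default value `0`, and both kernels vanish because
`R` is injective. -/
theorem IsResolvent.kerPow_eq {A : H →ₗ.[ℂ] H} {μ₀ : ℂ} {R : H →L[ℂ] H}
    (hR : IsResolvent A μ₀ R) (μ : ℂ) (k : ℕ) :
    kerPow A μ k = LinearMap.ker (((R : H →ₗ[ℂ] H) - (μ - μ₀)⁻¹ • 1) ^ k) := by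
  induction k with
  | zero => ext x; simp [kerPow]
  | succ k ih =>
    ext f
    set N : Module.End ℂ H := (R : H →ₗ[ℂ] H) - (μ - μ₀)⁻¹ • 1 with hN
    have hNR : ∀ x, (N ^ k) (R x) = R ((N ^ k) x) := by
      have hc : Commute N (R : H →ₗ[ℂ] H) :=
        (Commute.refl _).sub_left ((Commute.one_left _).smul_left _)
      intro x
      exact LinearMap.congr_fun (hc.pow_left k).eq x
    rw [mem_kerPow_succ, ih, LinearMap.mem_ker, pow_succ, Module.End.mul_apply]
    by_cases hμ : μ = μ₀
    · have hNR' : N = R := by simp [hN, hμ]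
      have hinj : ∀ (j : ℕ) y, (N ^ j) y = 0 → y = 0 := by
        intro j
        induction j with
        | zero => simp
        | succ j ihj =>
          intro y hy
          rw [pow_succ, Module.End.mul_apply] at hy
          have := ihj _ hy
          rw [hNR'] at this
          exact hR.injective (by simpa using this)
      constructor
      · rintro ⟨hf, h⟩
        have h1 := (hR _ _).1 (A.mem_graph ⟨f, hf⟩)
        have h2 := hinj _ _ h
        rw [← hμ, h2, map_zero] at h1
        rw [show f = 0 from h1.symm]
        simp
      · intro h
        have h1 : f = 0 := hinj (k + 1) f (by rwa [pow_succ, Module.End.mul_apply])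
        subst h1
        refine ⟨A.domain.zero_mem, ?_⟩
        have : A ⟨0, A.domain.zero_mem⟩ = 0 := A.map_zero
        simp [this]
    · have hμ' : μ - μ₀ ≠ 0 := sub_ne_zero.2 hμ
      have main : ∀ (hf : f ∈ A.domain), N f = -((μ - μ₀)⁻¹ • R (A ⟨f, hf⟩ - μ • f)) := by
        intro hf
        have h1 := (hR _ _).1 (A.mem_graph ⟨f, hf⟩)
        have h2 : A ⟨f, hf⟩ - μ • f = (A ⟨f, hf⟩ - μ₀ • f) - (μ - μ₀) • f := by module
        rw [h2, map_sub, show R (A ⟨f, hf⟩ - μ₀ • f) = f from h1, map_smul, smul_sub,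
          smul_smul, inv_mul_cancel₀ hμ', one_smul, hN]
        simp
      have hiff : ∀ (hf : f ∈ A.domain),
          (N ^ k) (A ⟨f, hf⟩ - μ • f) = 0 ↔ (N ^ k) (N f) = 0 := by
        intro hf
        rw [main hf, map_neg, map_smul, hNR, neg_eq_zero, smul_eq_zero,
          or_iff_right (inv_ne_zero hμ'), map_eq_zero_iff R hR.injective]
      constructor
      · rintro ⟨hf, h⟩
        exact (hiff hf).1 h
      · intro h
        -- Solving the definition of `N` for `y` expresses it through `R y` and `N y`: the former
        -- lies in the domain, the latter by induction.
        have hdom : ∀ (j : ℕ) y, (N ^ j) y = 0 → y ∈ A.domain := by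
          intro j
          induction j with
          | zero => intro y hy; simp only [pow_zero, Module.End.one_apply] at hy; simp [hy]
          | succ j ihj =>
            intro y hy
            rw [pow_succ, Module.End.mul_apply] at hy
            have h1 := ihj _ hy
            have h2 : y = (μ - μ₀) • (R y - N y) := by
              simp [hN, smul_smul, hμ']
            rw [h2]
            exact A.domain.smul_mem _ (A.domain.sub_mem ((hR.mem_domain_iff _).2 ⟨y, rfl⟩) h1)
        have hf := hdom (k + 1) f (by rwa [pow_succ, Module.End.mul_apply])
        exact ⟨hf, (hiff hf).2 h⟩

theorem IsResolvent.rootSpace_eq {A : H →ₗ.[ℂ] H} {μ₀ : ℂ} {R : H →L[ℂ] H}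
    (hR : IsResolvent A μ₀ R) (μ : ℂ) :
    rootSpace A μ = Module.End.maxGenEigenspace (R : H →ₗ[ℂ] H) (μ - μ₀)⁻¹ := by
  ext f
  rw [Module.End.mem_maxGenEigenspace]
  change (∃ k, f ∈ kerPow A μ k) ↔ _
  simp only [hR.kerPow_eq, LinearMap.mem_ker]

theorem exists_hilbertBasis_comp [CompleteSpace H] (ψ : HilbertBasis ℤ ℂ H) (σ : ℤ ≃ ℤ) :
    ∃ ψ' : HilbertBasis ℤ ℂ H, ∀ n, ψ' n = ψ (σ n) := by
  have h : (fun n => ψ (σ n)) = ψ ∘ σ := rfl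
  refine ⟨HilbertBasis.mk (v := fun n => ψ (σ n)) (ψ.orthonormal.comp σ σ.injective) ?_,
    fun n => by rw [HilbertBasis.coe_mk]⟩
  rw [h, σ.surjective.range_comp, ψ.dense_span]

/-- Changing finitely many members of a Riesz basis within their span and rescaling the others by
factors bounded above and away from zero yields a Riesz basis. -/
theorem IsRieszBasis.of_span [CompleteSpace H] {φ f : ℤ → H} (hφ : IsRieszBasis φ) {E : Finset ℤ}
    {c : ℤ → ℂ} {a C : ℝ} (ha : 0 < a) (hc : ∀ n ∉ E, a ≤ ‖c n‖ ∧ ‖c n‖ ≤ C)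
    (hf : ∀ n ∉ E, f n = c n • φ n) (hspan : ∀ n ∈ E, φ n ∈ Submodule.span ℂ (range f)) :
    IsRieszBasis f := by
  classical
  obtain ⟨S, ψ, hS⟩ := hφ
  obtain ⟨D, hD⟩ := exists_diagonal_equiv ψ (c := fun n => if n ∈ E then 1 else c n)
    (a := min a 1) (C := max C 1) (by positivity) (fun n => by
      by_cases hn : n ∈ E
      · simp [hn]
      · simp only [if_neg hn]
        exact ⟨(min_le_left _ _).trans (hc n hn).1, (hc n hn).2.trans (le_max_left _ _)⟩)
  let A : H ≃L[ℂ] H := D.trans S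
  have hAE : ∀ n ∈ E, A (ψ n) = φ n := fun n hn => by simp [A, hD, hn, hS]
  have hAE' : ∀ n ∉ E, A (ψ n) = f n := fun n hn => by simp [A, hD, hn, hS, hf]
  -- A finite rank correction makes `T` send every `ψ n` to `f n`.
  let T : H →L[ℂ] H := A + ∑ n ∈ E, (innerSL ℂ (ψ n)).smulRight (f n - φ n)
  have hTapp : ∀ x, T x = A x + ∑ n ∈ E, (inner ℂ (ψ n) x : ℂ) • (f n - φ n) := fun x => by
    simp [T]
  have hT : ∀ n, T (ψ n) = f n := by
    intro n
    rw [hTapp]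
    simp only [hilbertBasis_inner, ite_smul, one_smul, zero_smul, Finset.sum_ite_eq']
    by_cases hn : n ∈ E
    · rw [if_pos hn, hAE n hn]; abel
    · rw [if_neg hn, hAE' n hn, add_zero]
  have hrange : ∀ x ∈ Submodule.span ℂ (range f), ∃ y, T y = x := by
    have : Submodule.span ℂ (range f) ≤ LinearMap.range (T : H →ₗ[ℂ] H) := by
      rw [Submodule.span_le]
      rintro _ ⟨n, rfl⟩
      exact ⟨ψ n, hT n⟩
    exact fun x hx => this hx
  have hsurj : Function.Surjective T := by
    intro y
    -- With its coordinates in `E` removed, `x` does not feel the correction. The removed part is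
    -- sent by `A` into the span of the `φ n` with `n ∈ E`, which lies in the range of `T`.
    let x := A.symm y
    let z := ∑ n ∈ E, (inner ℂ (ψ n) x : ℂ) • ψ n
    have h1 : T (x - z) = A (x - z) := by
      rw [hTapp, add_eq_left]
      refine Finset.sum_eq_zero fun n hn => ?_
      have : inner ℂ (ψ n) (x - z) = 0 := by
        simp only [z, inner_sub_right, inner_sum, inner_smul_right, hilbertBasis_inner, mul_ite,
          mul_one, mul_zero, Finset.sum_ite_eq, if_pos hn, sub_self]
      rw [this, zero_smul]
    obtain ⟨w, hw⟩ := hrange (A z) (by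
      simp only [z, map_sum, map_smul]
      exact Submodule.sum_mem _ fun n hn => Submodule.smul_mem _ _ (by
        rw [hAE n hn]; exact hspan n hn))
    exact ⟨x - z + w, by rw [map_add, h1, hw, map_sub, sub_add_cancel]; simp [x]⟩
  obtain ⟨S', hS'⟩ := exists_equiv_of_injective ψ (T := T) (A := A) (F := E)
    (fun n hn => by rw [hT, hAE' n hn]) (Or.inr hsurj)
  exact ⟨S', ψ, fun n => by rw [hS', hT]⟩

theorem IsRieszBasis.linearIndependent {φ : ℤ → H} (hφ : IsRieszBasis φ) :
    LinearIndependent ℂ φ := by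
  obtain ⟨S, ψ, hS⟩ := hφ
  have := ψ.orthonormal.linearIndependent.map' (S : H →ₗ[ℂ] H) (LinearMap.ker_eq_bot.2 S.injective)
  rwa [show (φ = (S : H →ₗ[ℂ] H) ∘ ψ) from funext hS]

theorem IsRieszBasis.isSeminormalized {φ : ℤ → H} (hφ : IsRieszBasis φ) : IsSeminormalized φ := by
  obtain ⟨S, ψ, hS⟩ := hφ
  have h1 : ∀ n, 1 ≤ ‖(S.symm : H →L[ℂ] H)‖ * ‖φ n‖ := fun n => by
    have := (S.symm : H →L[ℂ] H).le_opNorm (φ n)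
    rw [hS] at this ⊢
    simpa [ψ.orthonormal.1 n] using this
  have h0 : 0 < ‖(S.symm : H →L[ℂ] H)‖ := by
    by_contra h
    have h2 : ‖(S.symm : H →L[ℂ] H)‖ = 0 := le_antisymm (not_lt.1 h) (norm_nonneg _)
    have := h1 0
    rw [h2] at this
    linarith
  refine ⟨‖(S.symm : H →L[ℂ] H)‖⁻¹, ‖(S : H →L[ℂ] H)‖, inv_pos.2 h0, fun n => ⟨?_, ?_⟩⟩
  · rw [inv_le_iff_one_le_mul₀' h0]
    exact h1 n
  · have := (S : H →L[ℂ] H).le_opNorm (ψ n)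
    rw [hS]
    simpa [ψ.orthonormal.1 n] using this

/-- One Riesz basis made up of bases of the root spaces, almost all of them simple, suffices. -/
theorem rootVectorsFormRieszBasis_of_isRieszBasis [CompleteSpace H] {A : H →ₗ.[ℂ] H} {φ : ℤ → H}
    {ev : ℤ → ℂ} (hφ : IsRieszBasis φ) (hfin : {n | ∃ m ≠ n, ev m = ev n}.Finite)
    (hspan : ∀ μ, Submodule.span ℂ (φ '' {n | ev n = μ}) = rootSpace A μ) :
    RootVectorsFormRieszBasis A := by
  classical
  have hLI := hφ.linearIndependent
  obtain ⟨a, C, ha, hn⟩ := hφ.isSeminormalized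
  have hpos : ∀ n, 0 < ‖φ n‖ := fun n => ha.trans_le (hn n).1
  refine ⟨⟨fun n => ((‖φ n‖ : ℂ)⁻¹) • φ n, ⟨ev, fun μ => ⟨?_, ?_⟩⟩, fun n => ?_⟩, ?_⟩
  · have h1 := hLI.units_smul fun n => (Units.mk0 (‖φ n‖ : ℂ) (by
      exact_mod_cast (hpos n).ne'))⁻¹
    have h2 := h1.comp (fun n : {n // ev n = μ} => (n : ℤ)) Subtype.val_injective
    convert h2 using 1
    ext n
    simp [Units.smul_def]
  · rw [← hspan μ]
    refine le_antisymm (Submodule.span_le.2 ?_) (Submodule.span_le.2 ?_)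
    · rintro _ ⟨⟨n, hn⟩, rfl⟩
      exact Submodule.smul_mem _ _ (Submodule.subset_span ⟨n, hn, rfl⟩)
    · rintro _ ⟨n, hn, rfl⟩
      have h1 : φ n = (‖φ n‖ : ℂ) • ((‖φ n‖ : ℂ)⁻¹ • φ n) := by
        rw [smul_smul, mul_inv_cancel₀ (by exact_mod_cast (hpos n).ne'), one_smul]
      rw [h1]
      exact Submodule.smul_mem _ _ (Submodule.subset_span ⟨⟨n, hn⟩, rfl⟩)
  · rw [norm_smul, norm_inv, Complex.norm_real, norm_norm, inv_mul_cancel₀ (hpos n).ne']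
  · rintro f ⟨ev', hev'⟩ ⟨a', C', ha', hn'⟩
    have hspan' : ∀ μ, Submodule.span ℂ (range fun n : {n // ev n = μ} => φ n) = rootSpace A μ := by
      intro μ
      rw [← hspan μ, image_eq_range]
      rfl
    have hequiv : ∀ μ, Nonempty ({n // ev' n = μ} ≃ {n // ev n = μ}) := fun μ => by
      have b₁ := (Module.Basis.span (hev' μ).1).map (LinearEquiv.ofEq _ _ (hev' μ).2)
      have b₂ := (Module.Basis.span (hLI.comp (fun n : {n // ev n = μ} => (n : ℤ))
        Subtype.val_injective)).map (LinearEquiv.ofEq _ _ (hspan' μ))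
      exact ⟨b₁.indexEquiv b₂⟩
    -- Two bases of the same root space have the same cardinality; gluing bijections over all `μ`
    -- gives a permutation matching the two labellings.
    let σ : ℤ ≃ ℤ := (Equiv.sigmaFiberEquiv ev').symm.trans
      ((Equiv.sigmaCongrRight fun μ => (hequiv μ).some).trans (Equiv.sigmaFiberEquiv ev))
    have hσ : ∀ n, ev (σ n) = ev' n := fun n => ((hequiv (ev' n)).some ⟨n, rfl⟩).2
    have hσ' : ∀ n, ev' (σ.symm n) = ev n := fun n => by rw [← hσ, σ.apply_symm_apply]
    have hmem : ∀ n, f (σ.symm n) ∈ rootSpace A (ev n) := fun n => by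
      rw [← (hev' (ev n)).2]
      exact Submodule.subset_span ⟨⟨_, hσ' n⟩, rfl⟩
    have hex : ∀ n, ∃ c : ℂ, n ∉ hfin.toFinset → f (σ.symm n) = c • φ n := by
      intro n
      by_cases h : n ∈ hfin.toFinset
      · exact ⟨0, fun h' => absurd h h'⟩
      · have h1 : {m | ev m = ev n} = {n} := by
          ext m
          simp only [Finite.mem_toFinset, mem_ofPred_eq, not_exists, not_and] at h
          exact ⟨fun hm => by_contra fun hmn => h m hmn hm, fun hm => by rw [hm]; rfl⟩
        have h2 := hmem n
        rw [← hspan, h1, image_singleton, Submodule.mem_span_singleton] at h2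
        obtain ⟨c, hc⟩ := h2
        exact ⟨c, fun _ => hc.symm⟩
    choose c hc using hex
    have hC : 0 < C := (hpos 0).trans_le (hn 0).2
    have hR : IsRieszBasis fun n => f (σ.symm n) := by
      refine hφ.of_span (E := hfin.toFinset) (c := c) (a := a' / C) (C := C' / a) (by positivity)
        (fun n hnE => ?_) hc fun n _ => ?_
      · have h1 := hn' (σ.symm n)
        rw [hc n hnE, norm_smul] at h1
        constructor
        · rw [div_le_iff₀ hC]
          exact h1.1.trans (mul_le_mul_of_nonneg_left (hn n).2 (norm_nonneg _))
        · rw [le_div_iff₀ ha]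
          exact (mul_le_mul_of_nonneg_left (hn n).1 (norm_nonneg _)).trans h1.2
      · have h1 : φ n ∈ rootSpace A (ev n) := by
          rw [← hspan]
          exact Submodule.subset_span ⟨n, rfl, rfl⟩
        rw [← (hev' (ev n)).2] at h1
        refine Submodule.span_mono ?_ h1
        rintro _ ⟨m, rfl⟩
        exact ⟨σ m, by simp⟩
    obtain ⟨S, ψ, hS⟩ := hR
    obtain ⟨ψ', hψ'⟩ := exists_hilbertBasis_comp ψ σ
    exact ⟨S, ψ', fun n => by simpa [hψ'] using hS (σ n)⟩

/-- An eigenvalue `ν` of `R` corresponds to `ν⁻¹ + μ₀`. This map is injective on all of `ℂ`, also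
with the convention `0⁻¹ = 0`. -/
theorem IsResolvent.rootVectorsFormRieszBasis [CompleteSpace H] {A : H →ₗ.[ℂ] H} {μ₀ : ℂ}
    {R : H →L[ℂ] H} (hR : IsResolvent A μ₀ R) (e : HilbertBasis ℤ ℂ H)
    {F : Finset ℤ} {f g : ℤ → H} {r : ℤ → ℂ} (hf : ∀ n ∉ F, R (f n) = r n • f n)
    (hg : ∀ n ∉ F, ∀ x, inner ℂ (g n) (R x) = r n * inner ℂ (g n) x)
    (hr : InjOn r {n | n ∉ F})
    (hfs : Summable fun n => ‖f n - e n‖ ^ 2) (hgs : Summable fun n => ‖g n - e n‖ ^ 2) :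
    RootVectorsFormRieszBasis A := by
  obtain ⟨φ, ev, hφ, hfin, hspan⟩ := exists_rieszBasis_maxGenEigenspace e R hf hg hr hfs hgs
  have hinj : Function.Injective fun ν : ℂ => ν⁻¹ + μ₀ := fun x y h =>
    inv_injective (add_right_cancel h)
  refine rootVectorsFormRieszBasis_of_isRieszBasis (ev := fun n => (ev n)⁻¹ + μ₀) hφ ?_ fun μ => ?_
  · simpa only [hinj.eq_iff] using hfin
  · rw [hR.rootSpace_eq, ← hspan]
    congr 2
    ext n
    simp only [mem_ofPred_eq]
    rw [← eq_sub_iff_add_eq, inv_eq_iff_eq_inv]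

/-- The same data serve the operator and its adjoint. -/
theorem IsResolvent.rootVectorsFormRieszBasis_and_adjoint [CompleteSpace H] {A : H →ₗ.[ℂ] H}
    {μ₀ : ℂ} {R : H →L[ℂ] H} (hR : IsResolvent A μ₀ R) (hA : Dense (A.domain : Set H))
    (e : HilbertBasis ℤ ℂ H) {F : Finset ℤ} {f g : ℤ → H} {r : ℤ → ℂ}
    (hf : ∀ n ∉ F, R (f n) = r n • f n)
    (hg : ∀ n ∉ F, ∀ x, inner ℂ (g n) (R x) = r n * inner ℂ (g n) x)
    (hr : InjOn r {n | n ∉ F})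
    (hfs : Summable fun n => ‖f n - e n‖ ^ 2) (hgs : Summable fun n => ‖g n - e n‖ ^ 2) :
    RootVectorsFormRieszBasis A ∧ RootVectorsFormRieszBasis A.adjoint := by
  -- Passing to the adjoint exchanges right and left eigenvectors and conjugates the eigenvalues.
  refine ⟨hR.rootVectorsFormRieszBasis e hf hg hr hfs hgs,
    (hR.adjoint hA).rootVectorsFormRieszBasis e (F := F) (f := g) (g := f)
      (r := fun n => starRingEnd ℂ (r n)) (fun n hn => ?_) (fun n hn x => ?_)
      (fun m hm n hn h => hr hm hn ((starRingEnd ℂ).injective h)) hgs hfs⟩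
  · refine ext_inner_right ℂ fun x => ?_
    rw [ContinuousLinearMap.adjoint_inner_left, hg n hn, inner_smul_left, Complex.conj_conj]
  · rw [ContinuousLinearMap.adjoint_inner_right, hf n hn, inner_smul_left]

end Abstract

/-! ### Estimates for the discrete Hilbert transform. -/

/-- The reciprocal distance of two integers, with value `0` on the diagonal. -/
def invDist (n k : ℤ) : ℝ := |(n : ℝ) - k|⁻¹

theorem invDist_nonneg (n k : ℤ) : 0 ≤ invDist n k := by unfold invDist; positivity

theorem invDist_comm (n k : ℤ) : invDist n k = invDist k n := by
  rw [invDist, invDist, abs_sub_comm]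

theorem invDist_sub (n k : ℤ) : invDist (n - k) 0 = invDist n k := by simp [invDist]

theorem invDist_le_one (n k : ℤ) : invDist n k ≤ 1 := by
  by_cases h : n = k
  · simp [invDist, h]
  · have h1 : (1 : ℝ) ≤ |(n : ℝ) - k| := by
      exact_mod_cast Int.one_le_abs (sub_ne_zero.2 h)
    exact inv_le_one_of_one_le₀ h1

theorem summable_invDist_zero : Summable fun k : ℤ => invDist k 0 ^ 2 := by
  refine (Real.summable_one_div_int_pow (p := 2).2 (by norm_num)).congr fun k => ?_
  simp [invDist]

theorem summable_invDist (n : ℤ) : Summable fun k : ℤ => invDist n k ^ 2 := by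
  have := (Equiv.subLeft n).summable_iff.2 summable_invDist_zero
  exact this.congr fun k => by simp [invDist_sub]

theorem tsum_invDist (n : ℤ) : ∑' k : ℤ, invDist n k ^ 2 = ∑' k : ℤ, invDist k 0 ^ 2 := by
  rw [← (Equiv.subLeft n).tsum_eq fun k => invDist k 0 ^ 2]
  exact tsum_congr fun k => by simp [invDist_sub]

/-- A convolution of two summable sequences: the shear `(n, k) ↦ (k, n - k)` turns the double series
into a product. -/
theorem summable_tsum_mul_invDist {a : ℤ → ℝ} (ha : Summable a) (h0 : ∀ k, 0 ≤ a k) :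
    Summable fun n : ℤ => ∑' k : ℤ, a k * invDist n k ^ 2 := by
  have h1 : Summable fun p : ℤ × ℤ => a p.1 * invDist p.2 0 ^ 2 :=
    ha.mul_of_nonneg summable_invDist_zero h0 fun k => sq_nonneg _
  let E : ℤ × ℤ ≃ ℤ × ℤ :=
    { toFun := fun p => (p.2, p.1 - p.2)
      invFun := fun p => (p.2 + p.1, p.1)
      left_inv := fun p => by simp
      right_inv := fun p => by simp }
  have h2 := E.summable_iff.2 h1
  have h3 := h2.prod
  simpa [E, Function.comp_def, invDist_sub] using h3

theorem summable_mul_invDist_sq {a : ℤ → ℝ} (ha : Summable a) (h0 : ∀ k, 0 ≤ a k) (n : ℤ) :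
    Summable fun k : ℤ => a k * invDist n k ^ 2 :=
  ha.of_nonneg_of_le (fun k => mul_nonneg (h0 k) (sq_nonneg _)) fun k =>
    mul_le_of_le_one_right (h0 k) (pow_le_one₀ (invDist_nonneg _ _) (invDist_le_one _ _))

theorem summable_mul_of_sq {a b : ℤ → ℝ} (ha : Summable fun k => a k ^ 2)
    (hb : Summable fun k => b k ^ 2) : Summable fun k => a k * b k := by
  refine Summable.of_norm_bounded (ha.add hb) fun k => ?_
  rw [Real.norm_eq_abs, abs_le]
  constructor <;> nlinarith [sq_nonneg (a k + b k), sq_nonneg (a k - b k)]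

/-- The arithmetic-geometric mean inequality in each term; the free weight `η` later balances a
small tail against a fixed constant. -/
theorem tsum_mul_le_of_sq {a b : ℤ → ℝ} (ha : Summable fun k => a k ^ 2)
    (hb : Summable fun k => b k ^ 2) {η : ℝ} (hη : 0 < η) :
    ∑' k, a k * b k ≤ η⁻¹ * ∑' k, a k ^ 2 + η * ∑' k, b k ^ 2 := by
  rw [← tsum_mul_left, ← tsum_mul_left, ← (ha.mul_left _).tsum_add (hb.mul_left _)]
  refine (summable_mul_of_sq ha hb).tsum_le_tsum (fun k => ?_) ((ha.mul_left _).add (hb.mul_left _))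
  have h1 : 0 ≤ η⁻¹ * (a k - η * b k) ^ 2 := by positivity
  have h2 : η⁻¹ * (a k - η * b k) ^ 2 = η⁻¹ * a k ^ 2 - 2 * (a k * b k) + η * b k ^ 2 := by
    field_simp
    ring
  have h3 : 0 ≤ η⁻¹ * a k ^ 2 + η * b k ^ 2 := by positivity
  linarith

/-- The discrete Hilbert transform of a square summable sequence, with absolute values, tends to
zero. -/
theorem tendsto_tsum_mul_invDist {a : ℤ → ℝ} (ha : Summable fun k => a k ^ 2) :
    Filter.Tendsto (fun n => ∑' k, |a k| * invDist n k) Filter.cofinite (nhds 0) := by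
  classical
  have hnn : ∀ n, 0 ≤ ∑' k, |a k| * invDist n k := fun n =>
    tsum_nonneg fun k => mul_nonneg (abs_nonneg _) (invDist_nonneg _ _)
  have ha' : Summable fun k => |a k| ^ 2 := by simpa using ha
  rw [Metric.tendsto_nhds]
  intro ε hε
  set Q := ∑' k : ℤ, invDist k 0 ^ 2 with hQ
  have hQ0 : 0 ≤ Q := tsum_nonneg fun k => sq_nonneg _
  -- The tail contributes at most `η⁻¹ · η ε/4 + η Q ≤ ε/2`, uniformly in `n`, and the finite part
  -- less than `ε/4` for almost all `n`.
  let η := ε / (4 * (Q + 1))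
  have hη : 0 < η := by positivity
  obtain ⟨s, hs⟩ := (exists_finset_tsum_lt (a := fun k => |a k| ^ 2)
    (ε := η * (ε / 4)) (by positivity)).exists
  have hfin : Filter.Tendsto (fun n => ∑ k ∈ s, |a k| * invDist n k) Filter.cofinite (nhds 0) := by
    rw [show (0 : ℝ) = ∑ k ∈ s, |a k| * 0 by simp]
    refine tendsto_finsetSum _ fun k _ => Filter.Tendsto.const_mul _ ?_
    have h1 := (summable_invDist k).tendsto_cofinite_zero
    have h2 := (Real.continuous_sqrt.tendsto 0).comp h1
    rw [Real.sqrt_zero] at h2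
    refine h2.congr fun n => ?_
    simp [Real.sqrt_sq (invDist_nonneg _ _), invDist_comm n k]
  filter_upwards [hfin.eventually_lt_const (show (0 : ℝ) < ε / 4 by positivity)] with n hn
  rw [Real.dist_eq, sub_zero, abs_of_nonneg (hnn n)]
  let a₁ : ℤ → ℝ := fun k => if k ∈ s then |a k| else 0
  let a₂ : ℤ → ℝ := fun k => if k ∈ s then 0 else |a k|
  have hb := summable_invDist n
  have h₁ : HasSum (fun k => a₁ k * invDist n k) (∑ k ∈ s, |a k| * invDist n k) := by
    rw [show ∑ k ∈ s, |a k| * invDist n k = ∑ k ∈ s, a₁ k * invDist n k from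
      Finset.sum_congr rfl fun k hk => by simp [a₁, hk]]
    exact hasSum_sum_of_ne_finset_zero fun k hk => by simp [a₁, hk]
  have ha₂ : (fun k => a₂ k ^ 2) = fun k => if k ∈ s then 0 else |a k| ^ 2 := by
    ext k; simp only [a₂]; split_ifs <;> simp
  have hs₂ : Summable fun k => a₂ k ^ 2 := by
    refine ha'.of_nonneg_of_le (fun k => sq_nonneg _) fun k => ?_
    rw [congrFun ha₂ k]
    split_ifs
    · positivity
    · exact le_rfl
  have h₂ := summable_mul_of_sq hs₂ hb
  have h₃ := tsum_mul_le_of_sq hs₂ hb hη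
  have h₄ : ∑' k, |a k| * invDist n k
      = ∑ k ∈ s, |a k| * invDist n k + ∑' k, a₂ k * invDist n k := by
    rw [← (h₁.add h₂.hasSum).tsum_eq]
    refine tsum_congr fun k => ?_
    simp only [a₁, a₂]
    split_ifs <;> ring
  rw [ha₂, tsum_invDist, ← hQ] at h₃
  have h₅ : η⁻¹ * ∑' k, (if k ∈ s then 0 else |a k| ^ 2) ≤ ε / 4 := by
    rw [inv_mul_le_iff₀ hη]; exact hs.le
  have h₆ : η * Q ≤ ε / 4 := by
    simp only [η]
    rw [div_mul_eq_mul_div, div_le_div_iff₀ (by positivity) (by norm_num)]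
    nlinarith
  rw [h₄]
  linarith

/-! ### Solving the characteristic equation near an integer. -/

section Fixed

variable {β : ℤ → ℂ}

/-- The summands of the regular part of the characteristic function near `n`. -/
def charTerm (β : ℤ → ℂ) (n : ℤ) (z : ℂ) (k : ℤ) : ℂ := if k = n then 0 else β k / (z - k)

/-- Distinct integers are at least `1` apart, so moving `n` by at most `1/3` costs less than half of
the distance to `k`. -/
theorem norm_inv_sub_le {n k : ℤ} {z : ℂ} (hz : ‖z - n‖ ≤ 1 / 3) (hk : k ≠ n) :
    z - k ≠ 0 ∧ ‖(z - k)⁻¹‖ ≤ 2 * invDist n k := by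
  have h1 : (1 : ℝ) ≤ |(n : ℝ) - k| := by
    exact_mod_cast Int.one_le_abs (sub_ne_zero.2 hk.symm)
  have h2 : ‖((n : ℂ) - k)‖ = |(n : ℝ) - k| := by
    rw [← Real.norm_eq_abs, ← Complex.norm_real]; push_cast; rfl
  have h3 : ‖((n : ℂ) - k)‖ ≤ ‖z - k‖ + ‖z - n‖ := by
    rw [show (n : ℂ) - k = (z - k) - (z - n) by ring]
    exact norm_sub_le _ _
  have h4 : |(n : ℝ) - k| / 2 ≤ ‖z - k‖ := by linarith
  have h5 : 0 < ‖z - k‖ := by linarith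
  refine ⟨norm_pos_iff.1 h5, ?_⟩
  rw [norm_inv, invDist, inv_le_comm₀ h5 (by positivity), mul_inv, inv_inv]
  linarith

theorem norm_charTerm_le {n : ℤ} {z : ℂ} (hz : ‖z - n‖ ≤ 1 / 3) (k : ℤ) :
    ‖charTerm β n z k‖ ≤ 2 * (‖β k‖ * invDist n k) := by
  unfold charTerm
  split_ifs with h
  · rw [norm_zero]; have := invDist_nonneg n k; positivity
  · rw [div_eq_mul_inv, norm_mul]
    have := (norm_inv_sub_le hz h).2
    nlinarith [norm_nonneg (β k)]

/-- The difference of reciprocals produces `invDist` squared; since `invDist ≤ 1`, one factor is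
dropped so that the same series controls size and Lipschitz constant. -/
theorem norm_charTerm_sub_le {n : ℤ} {z w : ℂ} (hz : ‖z - n‖ ≤ 1 / 3) (hw : ‖w - n‖ ≤ 1 / 3)
    (k : ℤ) : ‖charTerm β n z k - charTerm β n w k‖ ≤ 4 * ‖z - w‖ * (‖β k‖ * invDist n k) := by
  unfold charTerm
  have h0 := invDist_nonneg n k
  split_ifs with h
  · rw [sub_zero, norm_zero]; positivity
  · obtain ⟨hz1, hz2⟩ := norm_inv_sub_le hz h
    obtain ⟨hw1, hw2⟩ := norm_inv_sub_le hw h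
    have e1 : β k / (z - k) - β k / (w - k) = β k * ((w - z) * ((z - k)⁻¹ * (w - k)⁻¹)) := by
      field_simp
      ring
    rw [e1, norm_mul, norm_mul, norm_mul, norm_sub_rev w z]
    have h2 : ‖(z - k)⁻¹‖ * ‖(w - k)⁻¹‖ ≤ 4 * invDist n k := by
      have := mul_le_mul hz2 hw2 (norm_nonneg _) (by positivity)
      nlinarith [invDist_le_one n k]
    calc ‖β k‖ * (‖z - w‖ * (‖(z - k)⁻¹‖ * ‖(w - k)⁻¹‖))
        ≤ ‖β k‖ * (‖z - w‖ * (4 * invDist n k)) := by gcongr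
      _ = _ := by ring

theorem summable_norm_mul_invDist (hβ : Summable fun k => ‖β k‖ ^ 2) (n : ℤ) :
    Summable fun k => ‖β k‖ * invDist n k :=
  summable_mul_of_sq hβ (summable_invDist n)

theorem summable_charTerm (hβ : Summable fun k => ‖β k‖ ^ 2) {n : ℤ} {z : ℂ}
    (hz : ‖z - n‖ ≤ 1 / 3) : Summable (charTerm β n z) :=
  Summable.of_norm_bounded ((summable_norm_mul_invDist hβ n).mul_left 2) (norm_charTerm_le hz)

/-- For all but finitely many `n` the characteristic equation has a solution close to `n`. -/
theorem eventually_exists_eigenvalue (hβ : Summable fun k => ‖β k‖ ^ 2) :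
    ∀ᶠ n : ℤ in Filter.cofinite, ∃ z : ℂ, ‖z - n‖ ≤ 1 / 3 ∧ ‖∑' k, charTerm β n z k‖ ≤ 1 / 2 ∧
      (z - n) * (1 - ∑' k, charTerm β n z k) = β n := by
  have ht := tendsto_tsum_mul_invDist (a := fun k => ‖β k‖) hβ
  have hb : Filter.Tendsto (fun k => ‖β k‖ ^ 2) Filter.cofinite (nhds 0) :=
    hβ.tendsto_cofinite_zero
  -- With `1/8`, `σ` is bounded by `2/8` and has Lipschitz constant `4/8`; then `Φ` moves points at
  -- most `1/6` from `n` and contracts by `1/9`.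
  filter_upwards [ht.eventually_lt_const (show (0 : ℝ) < 1 / 8 by norm_num),
    hb.eventually_lt_const (show (0 : ℝ) < (1 / 8) ^ 2 by norm_num)] with n hn1 hn2
  simp only [abs_norm] at hn1
  have hn3 : ‖β n‖ ≤ 1 / 8 := (lt_of_pow_lt_pow_left₀ 2 (by norm_num) hn2).le
  have hs := summable_norm_mul_invDist hβ n
  let σ : ℂ → ℂ := fun z => ∑' k, charTerm β n z k
  have hσ : ∀ z : ℂ, ‖z - n‖ ≤ 1 / 3 → ‖σ z‖ ≤ 1 / 4 := fun z hz => by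
    have := tsum_of_norm_bounded (hs.mul_left 2).hasSum (norm_charTerm_le hz)
    rw [tsum_mul_left] at this
    simp only [σ]
    linarith
  have hσ' : ∀ z w : ℂ, ‖z - n‖ ≤ 1 / 3 → ‖w - n‖ ≤ 1 / 3 → ‖σ z - σ w‖ ≤ 1 / 2 * ‖z - w‖ := by
    intro z w hz hw
    have := tsum_of_norm_bounded (hs.mul_left (4 * ‖z - w‖)).hasSum (norm_charTerm_sub_le hz hw)
    rw [tsum_mul_left, (summable_charTerm hβ hz).tsum_sub (summable_charTerm hβ hw)] at this
    simp only [σ]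
    nlinarith [norm_nonneg (z - w)]
  have hσ1 : ∀ z : ℂ, ‖z - n‖ ≤ 1 / 3 → 3 / 4 ≤ ‖1 - σ z‖ := fun z hz => by
    have := norm_sub_norm_le (1 : ℂ) (σ z)
    rw [norm_one] at this
    linarith [hσ z hz]
  have hσ0 : ∀ z : ℂ, ‖z - n‖ ≤ 1 / 3 → 1 - σ z ≠ 0 := fun z hz =>
    norm_pos_iff.1 (by linarith [hσ1 z hz])
  let Φ : ℂ → ℂ := fun z => n + β n / (1 - σ z)
  have hinv : ∀ z : ℂ, ‖z - n‖ ≤ 1 / 3 → ‖(1 - σ z)⁻¹‖ ≤ 4 / 3 := fun z hz => by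
    rw [norm_inv, inv_le_comm₀ (by linarith [hσ1 z hz]) (by norm_num)]
    linarith [hσ1 z hz]
  have hmaps : MapsTo Φ (Metric.closedBall (n : ℂ) (1 / 3)) (Metric.closedBall (n : ℂ) (1 / 3)) := by
    intro z hz
    rw [mem_closedBall_iff_norm] at hz ⊢
    have e1 : Φ z - n = β n * (1 - σ z)⁻¹ := by simp only [Φ]; ring
    rw [e1, norm_mul]
    have := mul_le_mul hn3 (hinv z hz) (norm_nonneg _) (by norm_num)
    linarith
  have hcontr : ContractingWith (1 / 2) (hmaps.restrict Φ _ _) := by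
    refine ⟨by rw [← NNReal.coe_lt_coe]; norm_num, LipschitzWith.of_dist_le_mul ?_⟩
    rintro ⟨z, hz⟩ ⟨w, hw⟩
    rw [mem_closedBall_iff_norm] at hz hw
    change dist (Φ z) (Φ w) ≤ _ * dist z w
    rw [dist_eq_norm, dist_eq_norm]
    have e1 : Φ z - Φ w = β n * ((1 - σ z)⁻¹ * (1 - σ w)⁻¹ * (σ z - σ w)) := by
      simp only [Φ]
      have := hσ0 z hz
      have := hσ0 w hw
      field_simp
      ring
    rw [e1, norm_mul, norm_mul, norm_mul]
    have h1 := mul_le_mul (hinv z hz) (hinv w hw) (norm_nonneg _) (by norm_num)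
    calc ‖β n‖ * (‖(1 - σ z)⁻¹‖ * ‖(1 - σ w)⁻¹‖ * ‖σ z - σ w‖)
        ≤ 1 / 8 * (4 / 3 * (4 / 3) * (1 / 2 * ‖z - w‖)) := by
          gcongr
          exact hσ' z w hz hw
      _ ≤ 1 / 2 * ‖z - w‖ := by nlinarith [norm_nonneg (z - w)]
      _ = _ := by simp
  obtain ⟨z, hz, hfix, -⟩ := hcontr.exists_fixedPoint' Metric.isClosed_closedBall.isComplete hmaps
    (Metric.mem_closedBall_self (by norm_num)) (edist_ne_top _ _)
  rw [mem_closedBall_iff_norm] at hz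
  refine ⟨z, hz, (hσ z hz).trans (by norm_num), ?_⟩
  have h1 : z - n = β n / (1 - σ z) := by
    have : Φ z = z := hfix
    rw [sub_eq_iff_eq_add']
    exact this.symm
  change (z - n) * (1 - σ z) = β n
  rw [h1, div_mul_cancel₀ _ (hσ0 z hz)]

end Fixed

/-! ### The diagonal operator perturbed by the sum functional. -/

section Abstract

variable {H : Type*} [NormedAddCommGroup H] [InnerProductSpace ℂ H]

theorem hilbertBasis_hasSum_norm_sq (e : HilbertBasis ℤ ℂ H) (x : H) :
    HasSum (fun k => ‖inner ℂ (e k) x‖ ^ 2) (‖x‖ ^ 2) := by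
  have h := lp.hasSum_norm (p := 2) (by norm_num) (e.repr x)
  simpa [e.repr_apply_apply] using h

theorem hilbertBasis_exists_coeff (e : HilbertBasis ℤ ℂ H) {c : ℤ → ℂ}
    (hc : Summable fun k => ‖c k‖ ^ 2) : ∃ x : H, ∀ k, inner ℂ (e k) x = c k := by
  have hm : Memℓp c 2 := by
    rw [memℓp_gen_iff (by norm_num)]
    simpa using hc
  refine ⟨e.repr.symm ⟨c, hm⟩, fun k => ?_⟩
  rw [← e.repr_apply_apply, LinearIsometryEquiv.apply_symm_apply]

theorem hilbertBasis_eq (e : HilbertBasis ℤ ℂ H) {x y : H}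
    (h : ∀ k, inner ℂ (e k) x = inner ℂ (e k) y) : x = y := by
  rw [← sub_eq_zero]
  exact hilbertBasis_eq_zero e fun k => by rw [inner_sub_right, h, sub_self]

theorem hilbertBasis_hasSum_inner (e : HilbertBasis ℤ ℂ H) {w : H} {c : ℤ → ℂ}
    (hw : ∀ k, inner ℂ (e k) w = starRingEnd ℂ (c k)) (x : H) :
    HasSum (fun k => c k * inner ℂ (e k) x) (inner ℂ w x) := by
  refine (e.hasSum_inner_mul_inner w x).congr_fun fun k => ?_
  rw [← inner_conj_symm w, hw, Complex.conj_conj]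

theorem summable_norm_inner_sq (e : HilbertBasis ℤ ℂ H) (x : H) :
    Summable fun k => ‖inner ℂ (e k) x‖ ^ 2 :=
  (hilbertBasis_hasSum_norm_sq e x).summable

/-- Along `μ = it` the series tends to zero as `t → ∞` by dominated convergence. The last condition
is what makes the rank one correction in the resolvent invertible. -/
theorem exists_summable_inv_sub {β : ℤ → ℂ} (hβ : Summable fun k => ‖β k‖ ^ 2) :
    ∃ μ : ℂ, (∀ k : ℤ, (k : ℂ) - μ ≠ 0 ∧ ‖((k : ℂ) - μ)⁻¹‖ ≤ 1) ∧
      (Summable fun k : ℤ => ‖((k : ℂ) - μ)⁻¹‖ ^ 2) ∧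
      1 + ∑' k : ℤ, ((k : ℂ) - μ)⁻¹ * β k ≠ 0 := by
  have him : ∀ (t : ℝ) (k : ℤ), t ≤ ‖(k : ℂ) - t * Complex.I‖ := fun t k => by
    have h := Complex.abs_im_le_norm ((k : ℂ) - t * Complex.I)
    simp only [Complex.sub_im, Complex.intCast_im, Complex.mul_im, Complex.ofReal_re,
      Complex.I_im, mul_one, Complex.ofReal_im, Complex.I_re, mul_zero, add_zero, zero_sub,
      abs_neg] at h
    exact (le_abs_self t).trans h
  have hre : ∀ (t : ℝ) (k : ℤ), |(k : ℝ)| ≤ ‖(k : ℂ) - t * Complex.I‖ := fun t k => by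
    simpa using Complex.abs_re_le_norm ((k : ℂ) - t * Complex.I)
  -- The value `1` at `0` is needed because `invDist 0 0 = 0` cannot dominate.
  let d : ℤ → ℝ := fun k => if k = 0 then 1 else invDist k 0
  have hd : Summable fun k => d k ^ 2 := by
    refine (summable_congr_cofinite ?_).1 summable_invDist_zero
    filter_upwards [(finite_singleton (0 : ℤ)).compl_mem_cofinite] with k hk
    rw [show d k = invDist k 0 from if_neg hk]
  have hbound : ∀ t : ℝ, 1 ≤ t → ∀ k : ℤ, ‖((k : ℂ) - t * Complex.I)⁻¹‖ ≤ d k := by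
    intro t ht k
    rw [norm_inv]
    simp only [d]
    split_ifs with hk
    · exact inv_le_one_of_one_le₀ (ht.trans (him t k))
    · have : (0 : ℝ) < |(k : ℝ)| := abs_pos.2 (by exact_mod_cast hk)
      simpa [invDist] using inv_anti₀ this (hre t k)
  have hlim : Filter.Tendsto (fun t : ℝ => ∑' k : ℤ, ((k : ℂ) - t * Complex.I)⁻¹ * β k)
      Filter.atTop (nhds (∑' _ : ℤ, 0)) := by
    refine tendsto_tsum_of_dominated_convergence (bound := fun k => d k * ‖β k‖)
      (summable_mul_of_sq hd hβ) (fun k => ?_) ?_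
    · refine squeeze_zero_norm' (a := fun t : ℝ => t⁻¹ * ‖β k‖) ?_ ?_
      · filter_upwards [Filter.eventually_ge_atTop (1 : ℝ)] with t ht
        rw [norm_mul, norm_inv]
        gcongr
        exact him t k
      · simpa using tendsto_inv_atTop_zero.mul_const ‖β k‖
    · filter_upwards [Filter.eventually_ge_atTop (1 : ℝ)] with t ht k
      rw [norm_mul]
      gcongr
      exact hbound t ht k
  rw [tsum_zero] at hlim
  obtain ⟨t, ht, ht1⟩ := ((hlim.norm.eventually_lt_const (u := 1) (by simp)).and
    (Filter.eventually_ge_atTop (1 : ℝ))).exists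
  refine ⟨t * Complex.I, fun k => ⟨?_, ?_⟩, ?_, fun h => ?_⟩
  · exact norm_pos_iff.1 (by linarith [him t k])
  · rw [norm_inv]
    exact inv_le_one_of_one_le₀ (ht1.trans (him t k))
  · exact hd.of_nonneg_of_le (fun k => sq_nonneg _) fun k =>
      pow_le_pow_left₀ (norm_nonneg _) (hbound t ht1 k) 2
  · rw [add_comm, ← eq_neg_iff_add_eq_zero] at h
    rw [h, norm_neg, norm_one] at ht
    exact lt_irrefl _ ht

/-- The operator `f ↦ (k fₖ + s bₖ)ₖ`, `s = ∑ fₖ`, in the coordinates of an orthonormal basis. -/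
def IsDiagonalPlusSum (e : HilbertBasis ℤ ℂ H) (b : H) (A : H →ₗ.[ℂ] H) : Prop :=
  ∀ f h, (f, h) ∈ A.graph ↔ ∃ s, HasSum (fun k => inner ℂ (e k) f) s ∧
    ∀ k : ℤ, inner ℂ (e k) h = k * inner ℂ (e k) f + s * inner ℂ (e k) b

/-- Solving `(A - μ₀) f = x` coordinatewise gives `fₖ = cₖ (xₖ - s bₖ)` with `cₖ = (k - μ₀)⁻¹`.
Summing over `k` determines `s = ⟨w, x⟩ / (1 + ⟨w, b⟩)`, so `R` is a diagonal operator minus one of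
rank at most one. -/
theorem IsDiagonalPlusSum.exists_isResolvent {e : HilbertBasis ℤ ℂ H} {b : H} {A : H →ₗ.[ℂ] H}
    (hA : IsDiagonalPlusSum e b A) : ∃ (μ₀ : ℂ) (R : H →L[ℂ] H), IsResolvent A μ₀ R := by
  obtain ⟨μ₀, hμ, hsum, hne⟩ := exists_summable_inv_sub (summable_norm_inner_sq e b)
  let c : ℤ → ℂ := fun k => ((k : ℂ) - μ₀)⁻¹
  have hc : ∀ k : ℤ, ((k : ℂ) - μ₀) * c k = 1 := fun k => mul_inv_cancel₀ (hμ k).1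
  obtain ⟨D, -, hD⟩ := exists_diagonal e (c := c) (fun k => (hμ k).2)
  obtain ⟨w, hw⟩ := hilbertBasis_exists_coeff e (c := fun k => starRingEnd ℂ (c k))
    (by simpa only [Complex.norm_conj] using hsum)
  have hws := hilbertBasis_hasSum_inner e hw
  have hκ : 1 + inner ℂ w b ≠ 0 := by rwa [← (hws b).tsum_eq]
  let ρ : ℂ := (1 + inner ℂ w b)⁻¹
  have hρ : ρ * (1 + inner ℂ w b) = 1 := inv_mul_cancel₀ hκ
  let R : H →L[ℂ] H := D - (innerSL ℂ w).smulRight (ρ • D b)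
  have hR : ∀ k x, inner ℂ (e k) (R x)
      = c k * inner ℂ (e k) x - ρ * inner ℂ w x * (c k * inner ℂ (e k) b) := by
    intro k x
    have : R x = D x - (inner ℂ w x : ℂ) • (ρ • D b) := by simp [R]
    rw [this, inner_sub_right, inner_smul_right, inner_smul_right, hD, hD]
    ring
  refine ⟨μ₀, R, fun f h => ?_⟩
  rw [hA f h]
  constructor
  · rintro ⟨s, hs, hh⟩
    have h1 : ∀ k : ℤ, inner ℂ (e k) (h - μ₀ • f)
        = ((k : ℂ) - μ₀) * inner ℂ (e k) f + s * inner ℂ (e k) b := fun k => by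
      rw [inner_sub_right, inner_smul_right, hh]; ring
    have h2 : ∀ k : ℤ, c k * inner ℂ (e k) (h - μ₀ • f)
        = inner ℂ (e k) f + s * (c k * inner ℂ (e k) b) := fun k => by
      rw [h1]
      linear_combination inner ℂ (e k) f * hc k
    have h3 : inner ℂ w (h - μ₀ • f) = s + s * inner ℂ w b :=
      (hws _).unique ((hs.add ((hws b).mul_left s)).congr_fun fun k => h2 k)
    refine hilbertBasis_eq e fun k => ?_
    rw [hR, h2, h3]
    linear_combination -(s * (c k * inner ℂ (e k) b)) * hρ
  · intro hf
    let x := h - μ₀ • f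
    have hfk : ∀ k, inner ℂ (e k) f
        = c k * inner ℂ (e k) x - ρ * inner ℂ w x * (c k * inner ℂ (e k) b) := fun k => by
      rw [← hR, hf]
    refine ⟨ρ * inner ℂ w x, ?_, fun k => ?_⟩
    · have h1 := ((hws x).sub ((hws b).mul_left (ρ * inner ℂ w x))).congr_fun hfk
      have h2 : inner ℂ w x - ρ * inner ℂ w x * inner ℂ w b = ρ * inner ℂ w x := by
        linear_combination -inner ℂ w x * hρ
      rwa [h2] at h1
    · have h1 : inner ℂ (e k) h = inner ℂ (e k) x + μ₀ * inner ℂ (e k) f := by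
        simp [x]
      rw [h1]
      linear_combination (-(k : ℂ) + μ₀) * hfk k
        + (-inner ℂ (e k) x + ρ * inner ℂ w x * inner ℂ (e k) b) * hc k

/-- The equations `(z - k) fₖ = s bₖ` with `fₙ = 1` force `s = (1 - σ)⁻¹`, and the one for `k = n`
is `hzn`. Splitting off this term avoids dividing by `z - n`, which may vanish. The constant is `16
= 2² · 4`. -/
theorem exists_eigenvector {e : HilbertBasis ℤ ℂ H} {b : H} {n : ℤ} {z : ℂ}
    (hz : ‖z - n‖ ≤ 1 / 3)
    (hs : ‖∑' k, charTerm (fun k => inner ℂ (e k) b) n z k‖ ≤ 1 / 2)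
    (hzn : (z - n) * (1 - ∑' k, charTerm (fun k => inner ℂ (e k) b) n z k) = inner ℂ (e n) b) :
    ∃ f : H, inner ℂ (e n) f = 1 ∧
      ‖f - e n‖ ^ 2 ≤ 16 * ∑' k, ‖inner ℂ (e k) b‖ ^ 2 * invDist n k ^ 2 ∧
      ∀ A, IsDiagonalPlusSum e b A → (f, z • f) ∈ A.graph := by
  set β : ℤ → ℂ := fun k => inner ℂ (e k) b with hβdef
  set σ := ∑' k, charTerm β n z k with hσ
  have hβ : Summable fun k => ‖β k‖ ^ 2 := summable_norm_inner_sq e b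
  have hQ := summable_mul_invDist_sq hβ (fun k => sq_nonneg _) n
  have hσ1 : 1 / 2 ≤ ‖1 - σ‖ := by
    have := norm_sub_norm_le (1 : ℂ) σ
    rw [norm_one] at this
    linarith
  have hσ0 : 1 - σ ≠ 0 := norm_pos_iff.1 (by linarith)
  have hle : ∀ k, ‖charTerm β n z k‖ ^ 2 ≤ 4 * (‖β k‖ ^ 2 * invDist n k ^ 2) := fun k => by
    have := pow_le_pow_left₀ (norm_nonneg _) (norm_charTerm_le (β := β) hz k) 2
    linarith [mul_pow (2 : ℝ) (‖β k‖ * invDist n k) 2, mul_pow ‖β k‖ (invDist n k) 2]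
  have hcs : Summable fun k => ‖charTerm β n z k‖ ^ 2 :=
    (hQ.mul_left 4).of_nonneg_of_le (fun k => sq_nonneg _) hle
  obtain ⟨u, hu⟩ := hilbertBasis_exists_coeff e hcs
  have hun : ‖u‖ ^ 2 ≤ 4 * ∑' k, ‖β k‖ ^ 2 * invDist n k ^ 2 := by
    have h1 := hilbertBasis_hasSum_norm_sq e u
    simp only [hu] at h1
    rw [← h1.tsum_eq, ← tsum_mul_left]
    exact hcs.tsum_le_tsum hle (hQ.mul_left 4)
  have hinv : ‖(1 - σ)⁻¹‖ ≤ 2 := by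
    rw [norm_inv, inv_le_comm₀ (by linarith) (by norm_num)]
    linarith
  have hfk : ∀ k, inner ℂ (e k) (e n + (1 - σ)⁻¹ • u)
      = (if k = n then 1 else 0) + (1 - σ)⁻¹ * charTerm β n z k := fun k => by
    rw [inner_add_right, inner_smul_right, hilbertBasis_inner, hu]
  refine ⟨e n + (1 - σ)⁻¹ • u, by rw [hfk]; simp [charTerm], ?_, fun A hA => ?_⟩
  · rw [add_sub_cancel_left, norm_smul, mul_pow]
    have := pow_le_pow_left₀ (norm_nonneg _) hinv 2
    calc ‖(1 - σ)⁻¹‖ ^ 2 * ‖u‖ ^ 2 ≤ 2 ^ 2 * (4 * ∑' k, ‖β k‖ ^ 2 * invDist n k ^ 2) := by gcongr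
      _ = _ := by ring
  · refine (hA _ _).2 ⟨(1 - σ)⁻¹, ?_, fun k => ?_⟩
    · have h1 : HasSum (fun k : ℤ => if k = n then (1 : ℂ) else 0) 1 := hasSum_ite_eq n 1
      have h2 := (h1.add ((summable_charTerm hβ hz).hasSum.mul_left (1 - σ)⁻¹)).congr_fun hfk
      convert h2 using 1
      rw [← hσ]
      field_simp
      ring
    · rw [inner_smul_right, hfk]
      change _ = _ + (1 - σ)⁻¹ * β k
      by_cases hk : k = n
      · subst hk
        have h3 : β k = (z - k) * (1 - σ) := hzn.symm
        simp only [charTerm, if_pos, mul_zero, add_zero, mul_one, h3]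
        field_simp
        ring
      · have := (norm_inv_sub_le hz hk).1
        simp only [charTerm, if_neg hk, zero_add]
        field_simp
        ring

/-- A left eigenvector formally has the coefficients `(z - k)⁻¹`, up to conjugation; the factor `z -
n` removes the pole at `k = n`. Its size is at most `2 |bₙ|`, which supplies the square summability
over `n`. -/
theorem exists_adjoint_eigenvector {e : HilbertBasis ℤ ℂ H} {b : H} {n : ℤ} {z : ℂ}
    (hz : ‖z - n‖ ≤ 1 / 3)
    (hs : ‖∑' k, charTerm (fun k => inner ℂ (e k) b) n z k‖ ≤ 1 / 2)
    (hzn : (z - n) * (1 - ∑' k, charTerm (fun k => inner ℂ (e k) b) n z k) = inner ℂ (e n) b) :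
    ∃ g : H, ‖g - e n‖ ^ 2 ≤ (16 * ∑' k : ℤ, invDist k 0 ^ 2) * ‖inner ℂ (e n) b‖ ^ 2 ∧
      ∀ A, IsDiagonalPlusSum e b A → ∀ f h, (f, h) ∈ A.graph →
        inner ℂ g h = z * inner ℂ g f := by
  set β : ℤ → ℂ := fun k => inner ℂ (e k) b with hβdef
  set σ := ∑' k, charTerm β n z k with hσ
  have hβ : Summable fun k => ‖β k‖ ^ 2 := summable_norm_inner_sq e b
  have hQ := summable_invDist n
  let c : ℤ → ℂ := fun k => if k = n then 0 else (z - k)⁻¹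
  have hle : ∀ k, ‖starRingEnd ℂ (c k)‖ ^ 2 ≤ 4 * invDist n k ^ 2 := fun k => by
    rw [Complex.norm_conj]
    simp only [c]
    split_ifs with hk
    · rw [norm_zero, zero_pow two_ne_zero]; positivity
    · have := pow_le_pow_left₀ (norm_nonneg _) (norm_inv_sub_le hz hk).2 2
      linarith [mul_pow (2 : ℝ) (invDist n k) 2]
  have hcs : Summable fun k => ‖starRingEnd ℂ (c k)‖ ^ 2 :=
    (hQ.mul_left 4).of_nonneg_of_le (fun k => sq_nonneg _) hle
  obtain ⟨w, hw⟩ := hilbertBasis_exists_coeff e hcs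
  have hws := hilbertBasis_hasSum_inner e hw
  have hwn : ‖w‖ ^ 2 ≤ 4 * ∑' k : ℤ, invDist k 0 ^ 2 := by
    have h1 := hilbertBasis_hasSum_norm_sq e w
    simp only [hw] at h1
    rw [← h1.tsum_eq, ← tsum_invDist n, ← tsum_mul_left]
    exact hcs.tsum_le_tsum hle (hQ.mul_left 4)
  have hzβ : ‖z - n‖ ≤ 2 * ‖β n‖ := by
    have h1 : 1 / 2 ≤ ‖1 - σ‖ := by
      have := norm_sub_norm_le (1 : ℂ) σ
      rw [norm_one] at this
      linarith
    have h2 := congrArg norm hzn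
    rw [norm_mul] at h2
    change _ = ‖β n‖ at h2
    nlinarith [norm_nonneg (z - n)]
  refine ⟨e n + starRingEnd ℂ (z - n) • w, ?_, fun A hA f h hfh => ?_⟩
  · rw [add_sub_cancel_left, norm_smul, Complex.norm_conj, mul_pow]
    have := pow_le_pow_left₀ (norm_nonneg _) hzβ 2
    calc ‖z - n‖ ^ 2 * ‖w‖ ^ 2 ≤ (2 * ‖β n‖) ^ 2 * (4 * ∑' k : ℤ, invDist k 0 ^ 2) := by gcongr
      _ = _ := by simp only [hβdef]; ring
  · obtain ⟨s, hsf, hh⟩ := (hA f h).1 hfh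
    -- For `k ≠ n` the factor `(z - k)⁻¹` cancels `k - z`, leaving the sum of the `fₖ` without `fₙ`.
    have h1 : inner ℂ w h - z * inner ℂ w f = -(s - inner ℂ (e n) f) + s * σ := by
      have e1 := (hws h).sub ((hws f).mul_left z)
      have e2 := ((hsf.sub (hasSum_ite_eq n (inner ℂ (e n) f : ℂ))).neg.add
        ((summable_charTerm hβ hz).hasSum.mul_left s))
      refine e1.unique (e2.congr_fun fun k => ?_)
      rw [hh]
      simp only [c, charTerm, hβdef]
      split_ifs with hk
      · rw [hk]; ring
      · have := (norm_inv_sub_le hz hk).1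
        field_simp
        ring
    rw [inner_add_left, inner_add_left, inner_smul_left, inner_smul_left, Complex.conj_conj, hh]
    change (z - n) * (1 - σ) = inner ℂ (e n) b at hzn
    linear_combination (z - n) * h1 - s * hzn

/-- The root vectors of a diagonal operator with eigenvalues `k ∈ ℤ`, perturbed by
`f ↦ (∑ fₖ) b`, form a Riesz basis, and so do those of its adjoint. -/
theorem IsDiagonalPlusSum.rootVectorsFormRieszBasis [CompleteSpace H] {e : HilbertBasis ℤ ℂ H}
    {b : H} {A : H →ₗ.[ℂ] H} (hA : IsDiagonalPlusSum e b A) (hd : Dense (A.domain : Set H)) :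
    RootVectorsFormRieszBasis A ∧ RootVectorsFormRieszBasis A.adjoint := by
  classical
  obtain ⟨μ₀, R, hR⟩ := hA.exists_isResolvent
  have hβ := summable_norm_inner_sq e b
  have hfin : {n : ℤ | ¬ _}.Finite := eventually_exists_eigenvalue hβ
  have hex : ∀ n : ℤ, ∃ (z : ℂ) (f g : H), n ∉ hfin.toFinset → ‖z - n‖ ≤ 1 / 3 ∧
      f ≠ 0 ∧ (f, z • f) ∈ A.graph ∧
      ‖f - e n‖ ^ 2 ≤ 16 * ∑' k, ‖inner ℂ (e k) b‖ ^ 2 * invDist n k ^ 2 ∧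
      ‖g - e n‖ ^ 2 ≤ (16 * ∑' k : ℤ, invDist k 0 ^ 2) * ‖inner ℂ (e n) b‖ ^ 2 ∧
      ∀ f h, (f, h) ∈ A.graph → inner ℂ g h = z * inner ℂ g f := by
    intro n
    by_cases hn : n ∈ hfin.toFinset
    · exact ⟨0, 0, 0, fun h => absurd hn h⟩
    · rw [Finite.mem_toFinset] at hn
      obtain ⟨z, hz, hs, hzn⟩ := not_not.1 hn
      obtain ⟨f, hf1, hf2, hf3⟩ := exists_eigenvector hz hs hzn
      obtain ⟨g, hg1, hg2⟩ := exists_adjoint_eigenvector hz hs hzn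
      refine ⟨z, f, g, fun _ => ⟨hz, ?_, hf3 A hA, hf2, hg1, hg2 A hA⟩⟩
      rintro rfl
      simp at hf1
  choose z f g hprop using hex
  have hzμ : ∀ n ∉ hfin.toFinset, z n - μ₀ ≠ 0 := by
    intro n hn h0
    obtain ⟨-, hf0, hfg, -⟩ := hprop n hn
    have h1 := (hR _ _).1 hfg
    rw [← sub_smul, h0, zero_smul, map_zero] at h1
    exact hf0 h1.symm
  have hsum : ∀ (v : ℤ → H) (a : ℤ → ℝ), Summable a →
      (∀ n ∉ hfin.toFinset, ‖v n - e n‖ ^ 2 ≤ a n) → Summable fun n => ‖v n - e n‖ ^ 2 := by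
    intro v a ha hv
    refine Summable.of_norm_bounded_eventually ha ?_
    filter_upwards [hfin.toFinset.finite_toSet.compl_mem_cofinite] with n hn
    rw [Real.norm_of_nonneg (sq_nonneg _)]
    exact hv n hn
  refine hR.rootVectorsFormRieszBasis_and_adjoint hd e (F := hfin.toFinset) (f := f) (g := g)
    (r := fun n => (z n - μ₀)⁻¹) (fun n hn => ?_) (fun n hn x => ?_) (fun m hm n hn h => ?_) ?_ ?_
  · have h1 := (hR _ _).1 (hprop n hn).2.2.1
    rw [← sub_smul, map_smul] at h1
    rw [eq_inv_smul_iff₀ (hzμ n hn)]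
    exact h1
  · have h1 := (hprop n hn).2.2.2.2.2 (R x) (x + μ₀ • R x) ((hR _ _).2 (by simp))
    rw [inner_add_right, inner_smul_right] at h1
    rw [eq_inv_mul_iff_mul_eq₀ (hzμ n hn)]
    linear_combination -h1
  -- One number cannot lie within `1/3` of two different integers.
  · have hz : z m = z n := sub_left_injective (inv_injective h)
    have h1 := (hprop m hm).1
    have h2 := (hprop n hn).1
    rw [hz] at h1
    by_contra hmn
    have h3 : (1 : ℝ) ≤ ‖(m : ℂ) - n‖ := by
      rw [← Int.cast_sub, Complex.norm_intCast]
      exact_mod_cast Int.one_le_abs (sub_ne_zero.2 hmn)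
    have h4 : ‖(m : ℂ) - n‖ ≤ ‖z n - n‖ + ‖z n - m‖ := by
      rw [show (m : ℂ) - n = (z n - n) - (z n - m) by ring]
      exact norm_sub_le _ _
    linarith
  · exact hsum f _ ((summable_tsum_mul_invDist hβ fun k => sq_nonneg _).mul_left 16)
      fun n hn => (hprop n hn).2.2.2.1
  · exact hsum g _ (hβ.mul_left _) fun n hn => (hprop n hn).2.2.2.2.1

end Abstract

/-! ### The Fourier basis of `L²(0, 2π)`. -/

theorem two_pi_pos : (0 : ℝ) < 2 * Real.pi := by positivity

/-- The normalized exponentials `exp(-ikx) / √(2π)`. -/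
def wave (k : ℤ) (x : ℝ) : ℂ :=
  (Real.sqrt (2 * Real.pi) : ℂ)⁻¹ * Complex.exp (-(k * Complex.I) * x)

theorem sqrt_two_pi_ne_zero : (Real.sqrt (2 * Real.pi) : ℂ) ≠ 0 := by
  exact_mod_cast (Real.sqrt_pos.2 two_pi_pos).ne'

theorem sqrt_two_pi_mul_self :
    (Real.sqrt (2 * Real.pi) : ℂ) * Real.sqrt (2 * Real.pi) = 2 * Real.pi := by
  rw [← Complex.ofReal_mul, Real.mul_self_sqrt two_pi_pos.le]
  push_cast
  rfl

theorem hasDerivAt_wave (k : ℤ) (x : ℝ) :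
    HasDerivAt (wave k) (-(k * Complex.I) * wave k x) x := by
  have h1 : HasDerivAt (fun x : ℝ => -((k : ℂ) * Complex.I) * (x : ℂ)) (-(k * Complex.I)) x := by
    simpa using (Complex.ofRealCLM.hasDerivAt (x := x)).const_mul (-((k : ℂ) * Complex.I))
  have h2 := (h1.cexp).const_mul (Real.sqrt (2 * Real.pi) : ℂ)⁻¹
  exact h2.congr_deriv (by unfold wave; ring)

theorem continuous_wave (k : ℤ) : Continuous (wave k) := by
  unfold wave
  fun_prop

theorem norm_wave (k : ℤ) (x : ℝ) : ‖wave k x‖ = (Real.sqrt (2 * Real.pi))⁻¹ := by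
  have h : -((k : ℂ) * Complex.I) * x = ((-(k * x) : ℝ) : ℂ) * Complex.I := by push_cast; ring
  rw [wave, norm_mul, norm_inv, Complex.norm_real, h, Complex.norm_exp_ofReal_mul_I, mul_one,
    Real.norm_of_nonneg (Real.sqrt_nonneg _)]

theorem conj_wave (k : ℤ) (x : ℝ) : starRingEnd ℂ (wave k x) = wave (-k) x := by
  rw [wave, wave, map_mul, map_inv₀, Complex.conj_ofReal, ← Complex.exp_conj]
  simp

theorem wave_zero_right (k : ℤ) : wave k 0 = (Real.sqrt (2 * Real.pi) : ℂ)⁻¹ := by simp [wave]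

theorem wave_zero_left (x : ℝ) : wave 0 x = (Real.sqrt (2 * Real.pi) : ℂ)⁻¹ := by simp [wave]

theorem wave_two_pi (k : ℤ) : wave k (2 * Real.pi) = (Real.sqrt (2 * Real.pi) : ℂ)⁻¹ := by
  have h : -((k : ℂ) * Complex.I) * ((2 * Real.pi : ℝ) : ℂ)
      = ((-k : ℤ) : ℂ) * (2 * Real.pi * Complex.I) := by push_cast; ring
  rw [wave, h, Complex.exp_int_mul_two_pi_mul_I, mul_one]

theorem setIntegral_wave_mul (j k : ℤ) :
    ∫ x in Ioo 0 (2 * Real.pi), wave (-j) x * wave k x = if j = k then 1 else 0 := by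
  have h1 : ∀ x : ℝ, wave (-j) x * wave k x
      = (2 * Real.pi : ℂ)⁻¹ * Complex.exp (((j : ℂ) - k) * Complex.I * x) := by
    intro x
    rw [wave, wave, ← sqrt_two_pi_mul_self, mul_inv, mul_mul_mul_comm, ← Complex.exp_add]
    congr 2
    push_cast
    ring
  simp only [h1]
  rw [integral_const_mul, ← integral_Ioc_eq_integral_Ioo,
    ← intervalIntegral.integral_of_le two_pi_pos.le]
  split_ifs with h
  · have : (Real.pi : ℂ) ≠ 0 := by exact_mod_cast Real.pi_ne_zero
    simp [h]
    field_simp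
  · have hjk : ((j : ℂ) - k) * Complex.I ≠ 0 :=
      mul_ne_zero (sub_ne_zero.2 (by exact_mod_cast h)) Complex.I_ne_zero
    rw [integral_exp_mul_complex hjk]
    have h2 : ((j : ℂ) - k) * Complex.I * ((2 * Real.pi : ℝ) : ℂ)
        = ((j - k : ℤ) : ℂ) * (2 * Real.pi * Complex.I) := by push_cast; ring
    rw [h2, Complex.exp_int_mul_two_pi_mul_I]
    simp

/-- The exponentials as bounded continuous functions. -/
def waveBCF (k : ℤ) : BoundedContinuousFunction ℝ ℂ :=
  BoundedContinuousFunction.ofNormedAddCommGroup (wave k) (continuous_wave k) _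
    fun x => (norm_wave k x).le

/-- The exponentials as elements of `L²(0, 2π)`. -/
def waveL2 (k : ℤ) : L2 := BoundedContinuousFunction.toLp 2 intervalMeasure ℂ (waveBCF k)

theorem coeFn_waveL2 (k : ℤ) : waveL2 k =ᵐ[intervalMeasure] wave k :=
  BoundedContinuousFunction.coeFn_toLp (p := 2) intervalMeasure ℂ (waveBCF k)

theorem inner_eq_of_ae_eq {v : L2} {u : ℝ → ℂ} (h : v =ᵐ[intervalMeasure] u) (f : L2) :
    inner ℂ v f = ∫ x in Ioo 0 (2 * Real.pi), starRingEnd ℂ (u x) * f x := by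
  rw [L2.inner_def]
  refine integral_congr_ae ?_
  filter_upwards [h] with x hx
  rw [hx, RCLike.inner_apply, mul_comm]

theorem inner_waveL2 (k : ℤ) (f : L2) :
    inner ℂ (waveL2 k) f = ∫ x in Ioo 0 (2 * Real.pi), wave (-k) x * f x := by
  simp only [inner_eq_of_ae_eq (coeFn_waveL2 k), conj_wave]

theorem orthonormal_waveL2 : Orthonormal ℂ waveL2 := by
  rw [orthonormal_iff_ite]
  intro j k
  rw [inner_waveL2, ← setIntegral_wave_mul]
  refine integral_congr_ae ?_
  filter_upwards [coeFn_waveL2 k] with x hx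
  rw [hx]

/-- Completeness follows from Parseval's identity for the standard Fourier coefficients; the minus
sign in `wave` reverses the index. -/
theorem eq_zero_of_inner_waveL2 {u : L2} (h : ∀ k, inner ℂ (waveL2 k) u = 0) : u = 0 := by
  have hmem : MemLp u 2 (volume.restrict (Ioc 0 (2 * Real.pi))) := by
    rw [← restrict_Ioo_eq_restrict_Ioc]
    exact Lp.memLp u
  have h1 := hasSum_sq_fourierCoeffOn two_pi_pos hmem
  have h2 : ∀ n, fourierCoeffOn two_pi_pos u n = 0 := by
    intro n
    rw [fourierCoeffOn_eq_integral, intervalIntegral.integral_of_le two_pi_pos.le,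
      integral_Ioc_eq_integral_Ioo]
    have h3 := h (-n)
    rw [inner_waveL2, neg_neg] at h3
    have h4 : ∀ x : ℝ, (fourier (-n) : AddCircle (2 * Real.pi - 0) → ℂ) x • u x
        = (Real.sqrt (2 * Real.pi) : ℂ) * (wave n x * u x) := by
      intro x
      rw [fourier_coe_apply, wave, smul_eq_mul, ← mul_assoc, ← mul_assoc,
        mul_inv_cancel₀ sqrt_two_pi_ne_zero, one_mul]
      congr 2
      have : (Real.pi : ℂ) ≠ 0 := by exact_mod_cast Real.pi_ne_zero
      push_cast
      field_simp
      ring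
    simp only [h4]
    rw [integral_const_mul, h3, mul_zero, smul_zero]
  simp only [h2, norm_zero, ne_eq, OfNat.ofNat_ne_zero, not_false_eq_true, zero_pow] at h1
  have h5 := h1.unique hasSum_zero
  rw [smul_eq_zero, or_iff_right (inv_ne_zero (by simp [Real.pi_ne_zero])),
    intervalIntegral.integral_of_le two_pi_pos.le, integral_Ioc_eq_integral_Ioo] at h5
  rw [← inner_self_eq_zero (𝕜 := ℂ), L2.inner_def]
  have h6 : ∀ x, inner ℂ (u x) (u x) = ((‖u x‖ ^ 2 : ℝ) : ℂ) := fun x => by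
    rw [inner_self_eq_norm_sq_to_K]; push_cast; rfl
  simp only [h6]
  rw [integral_complex_ofReal, h5, Complex.ofReal_zero]

/-- The Fourier basis of `L²(0, 2π)`. -/
def waveBasis : HilbertBasis ℤ ℂ L2 :=
  HilbertBasis.mkOfOrthogonalEqBot orthonormal_waveL2 (by
    rw [Submodule.eq_bot_iff]
    intro u hu
    rw [Submodule.mem_orthogonal] at hu
    exact eq_zero_of_inner_waveL2 fun k => hu _ (Submodule.subset_span ⟨k, rfl⟩))

theorem waveBasis_apply (k : ℤ) : waveBasis k = waveL2 k := by
  rw [waveBasis, HilbertBasis.coe_mkOfOrthogonalEqBot]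

/-- An absolutely convergent Fourier series represents its sum. -/
theorem isContinuousRep_tsum {f : L2} (hf : Summable fun k => ‖inner ℂ (waveL2 k) f‖) :
    IsContinuousRep f fun x => ∑' k, inner ℂ (waveL2 k) f * wave k x := by
  have hn : ∀ k, ‖waveBCF k‖ ≤ (Real.sqrt (2 * Real.pi))⁻¹ := fun k =>
    (BoundedContinuousFunction.norm_le (by positivity)).2 fun x => (norm_wave k x).le
  have hs : Summable fun k => (inner ℂ (waveL2 k) f : ℂ) • waveBCF k := by
    refine Summable.of_norm_bounded (hf.mul_right (Real.sqrt (2 * Real.pi))⁻¹) fun k => ?_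
    rw [norm_smul]
    gcongr
    exact hn k
  have h1 := hs.hasSum.mapL (BoundedContinuousFunction.toLp (E := ℂ) 2 intervalMeasure ℂ)
  have h2 := waveBasis.hasSum_repr f
  simp only [waveBasis.repr_apply_apply, waveBasis_apply] at h2
  have h3 : BoundedContinuousFunction.toLp (E := ℂ) 2 intervalMeasure ℂ
      (∑' k, (inner ℂ (waveL2 k) f : ℂ) • waveBCF k) = f := by
    refine h1.unique (h2.congr_fun fun k => ?_)
    rw [map_smul]
    rfl
  have h4 : ∀ x, (∑' k, (inner ℂ (waveL2 k) f : ℂ) • waveBCF k) x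
      = ∑' k, inner ℂ (waveL2 k) f * wave k x := fun x => by
    have := hs.hasSum.mapL (BoundedContinuousFunction.evalCLM ℂ x)
    exact this.tsum_eq.symm
  have h5 : (fun x => ∑' k, inner ℂ (waveL2 k) f * wave k x)
      = ∑' k, (inner ℂ (waveL2 k) f : ℂ) • waveBCF k := funext fun x => (h4 x).symm
  rw [h5]
  refine ⟨(BoundedContinuousFunction.continuous _).continuousOn, ?_⟩
  conv_lhs => rw [← h3]
  exact BoundedContinuousFunction.coeFn_toLp (p := 2) intervalMeasure ℂ _

/-! ### Weak derivatives, boundary values and Fourier coefficients. -/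

theorem eq_zero_of_tsupport_subset {φ : ℝ → ℝ} (hs : tsupport φ ⊆ Ioo 0 (2 * Real.pi)) {x : ℝ}
    (hx : x ∉ Ioo 0 (2 * Real.pi)) : φ x = 0 :=
  image_eq_zero_of_notMem_tsupport fun hx' => hx (hs hx')

/-- Integration by parts against a test function. -/
theorem setIntegral_deriv_smul {φ : ℝ → ℝ} (hφ : ContDiff ℝ ∞ φ) (hc : HasCompactSupport φ)
    (hs : tsupport φ ⊆ Ioo 0 (2 * Real.pi)) {u u' : ℝ → ℂ} (hu : ∀ x, HasDerivAt u (u' x) x)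
    (hu' : Continuous u') :
    ∫ x in Ioo 0 (2 * Real.pi), deriv φ x • u x = - ∫ x in Ioo 0 (2 * Real.pi), φ x • u' x := by
  have hd : Continuous (deriv φ) := hφ.continuous_deriv (by simp)
  have huc : Continuous u := continuous_iff_continuousAt.2 fun x => (hu x).continuousAt
  have hsd : tsupport (deriv φ) ⊆ Ioo 0 (2 * Real.pi) := (tsupport_deriv_subset (𝕜 := ℝ)).trans hs
  rw [setIntegral_eq_integral_of_forall_compl_eq_zero fun x hx => by
      rw [eq_zero_of_tsupport_subset hsd hx, zero_smul],
    setIntegral_eq_integral_of_forall_compl_eq_zero fun x hx => by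
      rw [eq_zero_of_tsupport_subset hs hx, zero_smul]]
  have hi : ∀ {p : ℝ → ℝ} {q : ℝ → ℂ}, Continuous p → HasCompactSupport p → Continuous q →
      Integrable ((fun x => (p x : ℂ)) * q) := fun hp hpc hq =>
    ((Complex.continuous_ofReal.comp hp).mul hq).integrable_of_hasCompactSupport
      (HasCompactSupport.mul_right (hpc.comp_left (g := Complex.ofReal) Complex.ofReal_zero))
  have h := integral_mul_deriv_eq_deriv_mul_of_integrable (u := fun x => (φ x : ℂ)) (v := u)
    (u' := fun x => ((deriv φ x : ℝ) : ℂ)) (v' := u')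
    (fun x _ => ((hφ.differentiable (by simp) x).hasDerivAt).ofReal_comp) (fun x _ => hu x)
    (hi hφ.continuous hc hu') (hi hd hc.deriv huc) (hi hφ.continuous hc huc)
  simp only [Complex.real_smul]
  rw [h, neg_neg]

/-- A real test function as an element of `L²(0, 2π)`. -/
theorem exists_testL2 {φ : ℝ → ℝ} (hφ : Continuous φ) (hc : HasCompactSupport φ) :
    ∃ v : L2, v =ᵐ[intervalMeasure] fun x => (φ x : ℂ) := by
  have m : MemLp (fun x => (φ x : ℂ)) 2 intervalMeasure :=
    MemLp.mono_measure Measure.restrict_le_self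
      ((Complex.continuous_ofReal.comp hφ).memLp_of_hasCompactSupport
        (hc.comp_left (g := Complex.ofReal) Complex.ofReal_zero))
  exact ⟨m.toLp _, m.coeFn_toLp⟩

theorem inner_testL2 {φ : ℝ → ℝ} {v : L2} (h : v =ᵐ[intervalMeasure] fun x => (φ x : ℂ)) (f : L2) :
    inner ℂ v f = ∫ x in Ioo 0 (2 * Real.pi), φ x • f x := by
  rw [inner_eq_of_ae_eq h]
  simp

theorem inner_waveL2_testL2 {φ : ℝ → ℝ} {v : L2} (h : v =ᵐ[intervalMeasure] fun x => (φ x : ℂ))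
    (k : ℤ) : inner ℂ (waveL2 k) v = ∫ x in Ioo 0 (2 * Real.pi), φ x • wave (-k) x := by
  rw [inner_waveL2]
  refine integral_congr_ae ?_
  filter_upwards [h] with x hx
  rw [hx, Complex.real_smul, mul_comm]

/-- Fourier coefficients determine the weak derivative. -/
theorem hasWeakDeriv_of_inner_waveL2 {f g : L2}
    (h : ∀ k : ℤ, inner ℂ (waveL2 k) g = -(k * Complex.I) * inner ℂ (waveL2 k) f) :
    HasWeakDeriv f g := by
  intro φ hφ hc hs
  have hd : Continuous (deriv φ) := hφ.continuous_deriv (by simp)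
  obtain ⟨v, hv⟩ := exists_testL2 hφ.continuous hc
  obtain ⟨w, hw⟩ := exists_testL2 hd hc.deriv
  rw [← inner_testL2 hv, ← inner_testL2 hw]
  have hvw : ∀ k : ℤ, inner ℂ (waveL2 k) w = -(k * Complex.I) * inner ℂ (waveL2 k) v := by
    intro k
    rw [inner_waveL2_testL2 hv, inner_waveL2_testL2 hw,
      setIntegral_deriv_smul hφ hc hs (hasDerivAt_wave (-k)) (by
        exact continuous_const.mul (continuous_wave _)), ← integral_neg,
      ← integral_const_mul]
    refine integral_congr_ae (Filter.Eventually.of_forall fun x => ?_)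
    simp only [Complex.real_smul]
    push_cast
    ring
  -- Parseval's identity turns both pairings with the test function into series that agree term by
  -- term.
  have h1 := waveBasis.hasSum_inner_mul_inner w f
  have h2 := (waveBasis.hasSum_inner_mul_inner v g).neg
  simp only [waveBasis_apply] at h1 h2
  refine h1.unique (h2.congr_fun fun k => ?_)
  rw [h, ← inner_conj_symm w, ← inner_conj_symm v, hvw]
  simp only [map_mul, map_neg, Complex.conj_I, map_intCast]
  ring

/-- A primitive of a test function with mean zero is a test function. -/
theorem exists_test_primitive {θ : ℝ → ℝ} (hθ : ContDiff ℝ ∞ θ) (hc : HasCompactSupport θ)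
    (hs : tsupport θ ⊆ Ioo 0 (2 * Real.pi)) (h0 : ∫ x, θ x = 0) :
    ∃ φ : ℝ → ℝ, ContDiff ℝ ∞ φ ∧ HasCompactSupport φ ∧ tsupport φ ⊆ Ioo 0 (2 * Real.pi) ∧
      deriv φ = θ := by
  obtain ⟨a, b, ha, hb, hab⟩ : ∃ a b : ℝ, 0 < a ∧ b < 2 * Real.pi ∧ tsupport θ ⊆ Icc a b := by
    rcases (tsupport θ).eq_empty_or_nonempty with he | hne
    -- For `θ = 0` any empty interval will do.
    · exact ⟨1, 0, one_pos, two_pi_pos, by rw [he]; exact empty_subset _⟩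
    · obtain ⟨a, ha⟩ := hc.isCompact.exists_isLeast hne
      obtain ⟨b, hb⟩ := hc.isCompact.exists_isGreatest hne
      exact ⟨a, b, (hs ha.1).1, (hs hb.1).2, fun x hx => ⟨ha.2 hx, hb.2 hx⟩⟩
  have hz : ∀ x, x ∉ Icc a b → θ x = 0 := fun x hx =>
    image_eq_zero_of_notMem_tsupport fun hx' => hx (hab hx')
  let φ : ℝ → ℝ := fun x => ∫ y in (0 : ℝ)..x, θ y
  have hd : ∀ x, HasDerivAt φ (θ x) x := fun x =>
    hθ.continuous.integral_hasStrictDerivAt 0 x |>.hasDerivAt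
  have hderiv : deriv φ = θ := funext fun x => (hd x).deriv
  have hφ0 : ∀ x, x ∉ Icc a b → φ x = 0 := by
    intro x hx
    rcases lt_or_ge x a with hxa | hxa
    · have : EqOn θ (fun _ => 0) (uIcc 0 x) := fun y hy => hz y fun hy' => by
        have := hy.2
        rcases le_max_iff.1 this with h | h <;> linarith [hy'.1]
      simp only [φ]
      rw [intervalIntegral.integral_congr this, intervalIntegral.integral_zero]
    · have hbx : b < x := not_le.1 fun h => hx ⟨hxa, h⟩
      have : Function.support θ ⊆ Ioc 0 x := fun y hy => by
        have hy' : y ∈ Icc a b := by_contra fun h => hy (hz y h)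
        exact ⟨ha.trans_le hy'.1, hy'.2.trans hbx.le⟩
      simp only [φ]
      rw [intervalIntegral.integral_eq_integral_of_support_subset this, h0]
  have hsupp : tsupport φ ⊆ Icc a b :=
    closure_minimal (fun x hx => by_contra fun h => hx (hφ0 x h)) isClosed_Icc
  refine ⟨φ, ?_, HasCompactSupport.intro isCompact_Icc hφ0, fun x hx => ?_, hderiv⟩
  · rw [contDiff_infty_iff_deriv, hderiv]
    exact ⟨fun x => (hd x).differentiableAt, hθ⟩
  · exact ⟨ha.trans_le (hsupp hx).1, (hsupp hx).2.trans_lt hb⟩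

/-- The lemma of du Bois-Reymond. -/
theorem HasWeakDeriv.ae_eq_const {f : L2} (h : HasWeakDeriv f 0) :
    ∃ c : ℂ, f =ᵐ[intervalMeasure] fun _ => c := by
  obtain ⟨χ, hχs, hχc, hχ, hχr, hχ1⟩ := exists_contDiff_tsupport_subset (n := ⊤)
    (Ioo_mem_nhds Real.pi_pos (show Real.pi < 2 * Real.pi by linarith [Real.pi_pos]))
  have hχpos : 0 < ∫ x, χ x := by
    refine hχ.continuous.integral_pos_of_hasCompactSupport_nonneg_nonzero hχc
      (fun x => (hχr ⟨x, rfl⟩).1) (x := Real.pi) (by rw [hχ1]; exact one_ne_zero)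
  have hf : Integrable f intervalMeasure := (Lp.memLp f).integrable (by norm_num)
  let c : ℂ := ((∫ x, χ x : ℝ) : ℂ)⁻¹ * ∫ x in Ioo 0 (2 * Real.pi), χ x • f x
  refine ⟨c, ?_⟩
  have hfc : Integrable (fun x => f x - c) intervalMeasure := hf.sub (integrable_const c)
  have key := (isOpen_Ioo (a := (0 : ℝ)) (b := 2 * Real.pi)).ae_eq_zero_of_integral_contDiff_smul_eq_zero
    (μ := volume) (f := fun x => f x - c) (IntegrableOn.locallyIntegrableOn hfc) (by
      intro ψ hψ hψc hψs
      let m : ℝ := (∫ x, ψ x) / ∫ x, χ x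
      -- Subtracting a multiple of the bump `χ` makes the mean zero, so that `θ` is the derivative
      -- of a test function.
      let θ : ℝ → ℝ := fun x => ψ x - m * χ x
      have hθ : ContDiff ℝ ∞ θ := hψ.sub (contDiff_const.mul hχ)
      have hθc : HasCompactSupport θ := hψc.sub hχc.mul_left
      have hθs : tsupport θ ⊆ Ioo 0 (2 * Real.pi) :=
        (tsupport_sub ψ fun x => m * χ x).trans (union_subset hψs
          ((tsupport_mul_subset_right (f := fun _ => m) (g := χ)).trans hχs))
      have hψi : Integrable ψ := hψ.continuous.integrable_of_hasCompactSupport hψc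
      have hχi : Integrable χ := hχ.continuous.integrable_of_hasCompactSupport hχc
      have hθ0 : ∫ x, θ x = 0 := by
        simp only [θ]
        rw [integral_sub hψi (hχi.const_mul m), integral_const_mul]
        simp only [m]
        rw [div_mul_cancel₀ _ hχpos.ne', sub_self]
      obtain ⟨φ, hφ, hφc, hφs, hφd⟩ := exists_test_primitive hθ hθc hθs hθ0
      have h1 := h φ hφ hφc hφs
      have h2 : ∫ x in Ioo 0 (2 * Real.pi), φ x • (0 : L2) x = 0 := by
        refine integral_eq_zero_of_ae ?_
        filter_upwards [Lp.coeFn_zero ℂ 2 intervalMeasure] with x hx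
        rw [hx]; simp
      rw [h2, neg_zero, hφd] at h1
      have h3 : ∫ x in Ioo 0 (2 * Real.pi), θ x • f x
          = (∫ x in Ioo 0 (2 * Real.pi), ψ x • f x)
            - m * ∫ x in Ioo 0 (2 * Real.pi), χ x • f x := by
        rw [← integral_const_mul, ← integral_sub (integrable_smul hψ.continuous hψc f)
          ((integrable_smul hχ.continuous hχc f).const_mul _)]
        refine integral_congr_ae (Filter.Eventually.of_forall fun x => ?_)
        simp only [θ, Complex.real_smul]
        push_cast
        ring
      have h4 : ∫ x, ψ x • (f x - c) = ∫ x in Ioo 0 (2 * Real.pi), ψ x • (f x - c) :=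
        (setIntegral_eq_integral_of_forall_compl_eq_zero fun x hx => by
          rw [eq_zero_of_tsupport_subset hψs hx, zero_smul]).symm
      have h5 : ∫ x in Ioo 0 (2 * Real.pi), (ψ x : ℂ) = ((∫ x, ψ x : ℝ) : ℂ) := by
        rw [← integral_complex_ofReal, setIntegral_eq_integral_of_forall_compl_eq_zero]
        intro x hx
        rw [eq_zero_of_tsupport_subset hψs hx, Complex.ofReal_zero]
      have h6 : ∫ x in Ioo 0 (2 * Real.pi), ψ x • (f x - c)
          = (∫ x in Ioo 0 (2 * Real.pi), ψ x • f x) - ((∫ x, ψ x : ℝ) : ℂ) * c := by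
        have hψc' : Integrable (fun x => (ψ x : ℂ) * c) intervalMeasure :=
          hψi.ofReal.restrict.mul_const c
        rw [← h5, ← integral_mul_const, ← integral_sub (integrable_smul hψ.continuous hψc f) hψc']
        refine integral_congr_ae (Filter.Eventually.of_forall fun x => ?_)
        simp only [Complex.real_smul]
        ring
      rw [h4, h6]
      rw [h3] at h1
      have h7 : ((∫ x, χ x : ℝ) : ℂ) ≠ 0 := by exact_mod_cast hχpos.ne'
      simp only [m, c] at h1 ⊢
      push_cast at h1
      rw [← h1]
      ring)
  have := (ae_restrict_iff' measurableSet_Ioo).2 key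
  filter_upwards [this] with x hx
  exact sub_eq_zero.1 hx

theorem HasWeakDeriv.sub {f₁ f₂ g₁ g₂ : L2} (h₁ : HasWeakDeriv f₁ g₁) (h₂ : HasWeakDeriv f₂ g₂) :
    HasWeakDeriv (f₁ - f₂) (g₁ - g₂) := by
  simpa [sub_eq_add_neg] using h₁.add (h₂.smul (-1))

/-- The linear function with slope `m` and its weak derivative. -/
theorem exists_linear_hasWeakDeriv (m : ℂ) : ∃ X M : L2,
    X =ᵐ[intervalMeasure] (fun x => m * x) ∧ M =ᵐ[intervalMeasure] (fun _ => m) ∧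
      HasWeakDeriv X M := by
  have hX : MemLp (fun x : ℝ => m * (x : ℂ)) 2 intervalMeasure := by
    refine MemLp.of_bound (by fun_prop) (‖m‖ * (2 * Real.pi)) ?_
    refine (ae_restrict_iff' measurableSet_Ioo).2 (Filter.Eventually.of_forall fun x hx => ?_)
    rw [norm_mul, Complex.norm_real, Real.norm_of_nonneg hx.1.le]
    gcongr
    exact hx.2.le
  have hM : MemLp (fun _ : ℝ => m) 2 intervalMeasure := memLp_const m
  refine ⟨hX.toLp _, hM.toLp _, hX.coeFn_toLp, hM.coeFn_toLp, fun φ hφ hc hs => ?_⟩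
  have hd : ∀ x : ℝ, HasDerivAt (fun x : ℝ => m * (x : ℂ)) m x := fun x => by
    simpa using (Complex.ofRealCLM.hasDerivAt (x := x)).const_mul m
  have h1 := setIntegral_deriv_smul hφ hc hs hd continuous_const
  have e1 : ∫ x in Ioo 0 (2 * Real.pi), deriv φ x • (hX.toLp _ : L2) x
      = ∫ x in Ioo 0 (2 * Real.pi), deriv φ x • (m * (x : ℂ)) := by
    refine integral_congr_ae ?_
    filter_upwards [hX.coeFn_toLp] with x hx
    rw [hx]
  have e2 : ∫ x in Ioo 0 (2 * Real.pi), φ x • (hM.toLp _ : L2) x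
      = ∫ x in Ioo 0 (2 * Real.pi), φ x • m := by
    refine integral_congr_ae ?_
    filter_upwards [hM.coeFn_toLp] with x hx
    rw [hx]
  rw [e1, e2, h1]

theorem inner_waveL2_waveL2 (j k : ℤ) :
    inner ℂ (waveL2 j) (waveL2 k) = if j = k then 1 else 0 :=
  orthonormal_iff_ite.1 orthonormal_waveL2 j k

/-- The Fourier coefficients of a periodic `H¹` function and of its derivative. -/
theorem HasWeakDeriv.inner_waveL2_of_periodic {f g : L2} {F : ℝ → ℂ} (hfg : HasWeakDeriv f g)
    (hF : IsContinuousRep f F) (hper : F 0 = F (2 * Real.pi)) :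
    (∀ k : ℤ, inner ℂ (waveL2 k) g = -(k * Complex.I) * inner ℂ (waveL2 k) f) ∧
      HasSum (fun k => inner ℂ (waveL2 k) f) (Real.sqrt (2 * Real.pi) * F (2 * Real.pi)) := by
  set r : ℂ := (Real.sqrt (2 * Real.pi) : ℂ) with hr
  have hr0 : r ≠ 0 := sqrt_two_pi_ne_zero
  let γ : ℤ → ℂ := fun k => inner ℂ (waveL2 k) g
  have hγ : Summable fun k => ‖γ k‖ ^ 2 := by
    simpa only [waveBasis_apply] using summable_norm_inner_sq waveBasis g
  -- The coefficients of a primitive of `g` without its mean; `α 0 = 0` because `0⁻¹ = 0`. The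
  -- exponentials do not vanish at the end points and cannot serve as test functions, hence the
  -- detour through a primitive.
  let α : ℤ → ℂ := fun k => Complex.I * γ k * (k : ℂ)⁻¹
  have hαγ : ∀ k : ℤ, k ≠ 0 → -((k : ℂ) * Complex.I) * α k = γ k := fun k hk => by
    have hk' : (k : ℂ) ≠ 0 := by exact_mod_cast hk
    have h1 : -((k : ℂ) * Complex.I) * (Complex.I * γ k * (k : ℂ)⁻¹)
        = -(Complex.I * Complex.I) * γ k * ((k : ℂ) * (k : ℂ)⁻¹) := by ring
    simp only [α]
    rw [h1, Complex.I_mul_I, mul_inv_cancel₀ hk', neg_neg, one_mul, mul_one]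
  have hα : ∀ k, ‖α k‖ = ‖γ k‖ * invDist k 0 := fun k => by
    simp only [α, invDist]
    rw [norm_mul, norm_mul, Complex.norm_I, one_mul, norm_inv, Complex.norm_intCast]
    simp
  have hα1 : Summable fun k => ‖α k‖ := by
    simp only [hα]
    exact summable_mul_of_sq hγ summable_invDist_zero
  have hα2 : Summable fun k => ‖α k‖ ^ 2 := by
    simp only [hα, mul_pow]
    simpa only [invDist_comm 0] using summable_mul_invDist_sq hγ (fun k => sq_nonneg _) 0
  obtain ⟨p, hp⟩ := hilbertBasis_exists_coeff waveBasis hα2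
  simp only [waveBasis_apply] at hp
  have hpg : HasWeakDeriv p (g - γ 0 • waveL2 0) := hasWeakDeriv_of_inner_waveL2 fun k => by
    rw [inner_sub_right, inner_smul_right, inner_waveL2_waveL2, hp]
    by_cases hk : k = 0
    · simp [hk, γ]
    · rw [if_neg hk, mul_zero, sub_zero, hαγ k hk]
  have hprep := isContinuousRep_tsum (f := p) (by simpa only [hp] using hα1)
  simp only [hp] at hprep
  let G : ℝ → ℂ := fun x => ∑' k, α k * wave k x
  have hG0 : G 0 = (∑' k, α k) * r⁻¹ := by
    simp only [G, wave_zero_right]; rw [tsum_mul_right]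
  have hG1 : G (2 * Real.pi) = (∑' k, α k) * r⁻¹ := by
    simp only [G, wave_two_pi]; rw [tsum_mul_right]
  obtain ⟨X, M, hX, hM, hXM⟩ := exists_linear_hasWeakDeriv (γ 0 * r⁻¹)
  have hM' : M = γ 0 • waveL2 0 := by
    refine Lp.ext ?_
    filter_upwards [hM, Lp.coeFn_smul (γ 0) (waveL2 0), coeFn_waveL2 0] with x h1 h2 h3
    rw [h1, h2, Pi.smul_apply, h3, wave_zero_left, smul_eq_mul]
  -- The linear function `X` accounts for the mean of `g`, so `f` is a periodic function plus a
  -- linear one plus a constant.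
  have hzero : HasWeakDeriv (f - p - X) 0 := by
    have := (hfg.sub hpg).sub hXM
    rwa [hM', sub_sub_cancel, sub_self] at this
  obtain ⟨c, hc⟩ := hzero.ae_eq_const
  have hfae : f =ᵐ[intervalMeasure] fun x => G x + γ 0 * r⁻¹ * x + c := by
    filter_upwards [hc, Lp.coeFn_sub (f - p) X, Lp.coeFn_sub f p, hX, hprep.2] with x h1 h2 h3 h4 h5
    rw [h2, Pi.sub_apply, h3, Pi.sub_apply, h4, h5] at h1
    rw [← h1]
    simp only [G]
    ring
  have hFG : EqOn F (fun x => G x + γ 0 * r⁻¹ * x + c) (Icc 0 (2 * Real.pi)) := by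
    refine Measure.eqOn_Icc_of_ae_eq volume two_pi_pos.ne ?_ hF.1
      ((hprep.1.add (by fun_prop)).add continuousOn_const)
    rw [← restrict_Ioo_eq_restrict_Icc]
    exact hF.2.symm.trans hfae
  have h0 := hFG (left_mem_Icc.2 two_pi_pos.le)
  have h1 := hFG (right_mem_Icc.2 two_pi_pos.le)
  simp only [hG0, hG1, Complex.ofReal_zero, mul_zero, add_zero] at h0 h1
  -- Equal boundary values of `F` and of `G` leave no room for a linear part.
  have hγ0 : γ 0 = 0 := by
    rw [hper, h1] at h0
    have h2 : γ 0 * r⁻¹ * ((2 * Real.pi : ℝ) : ℂ) = 0 := by linear_combination h0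
    have h3 : ((2 * Real.pi : ℝ) : ℂ) ≠ 0 := by exact_mod_cast two_pi_pos.ne'
    exact (mul_eq_zero.1 ((mul_eq_zero.1 h2).resolve_right h3)).resolve_right (inv_ne_zero hr0)
  have hf : f = p + (c * r) • waveL2 0 := by
    refine Lp.ext ?_
    filter_upwards [hfae, Lp.coeFn_add p ((c * r) • waveL2 0), Lp.coeFn_smul (c * r) (waveL2 0),
      coeFn_waveL2 0, hprep.2] with x h2 h3 h4 h5 h6
    rw [h2, h3, Pi.add_apply, h4, Pi.smul_apply, h5, h6, wave_zero_left, smul_eq_mul, hγ0,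
      mul_assoc c, ← hr, mul_inv_cancel₀ hr0]
    simp [G]
  have hfk : ∀ k, inner ℂ (waveL2 k) f = α k + if k = 0 then c * r else 0 := fun k => by
    rw [hf, inner_add_right, inner_smul_right, hp, inner_waveL2_waveL2]
    simp
  constructor
  · intro k
    rw [hfk]
    by_cases hk : k = 0
    · subst hk
      simpa [γ] using hγ0
    · rw [if_neg hk, add_zero, hαγ k hk]
  · have h2 := (hα1.of_norm.hasSum.add (hasSum_ite_eq (0 : ℤ) (c * r))).congr_fun hfk
    have h3 : r * F (2 * Real.pi) = ∑' k, α k + c * r := by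
      rw [h1, hγ0]
      field_simp
      ring
    rwa [h3]

/-- In the Fourier basis `P_{1,K}` is a diagonal operator perturbed by a sum functional. -/
theorem isDiagonalPlusSum_momentumOp (K : L2) :
    IsDiagonalPlusSum waveBasis ((Real.sqrt (2 * Real.pi) : ℂ)⁻¹ • K) (momentumOp K) := by
  intro f h
  rw [mem_graph_momentumOp]
  simp only [waveBasis_apply, inner_smul_right]
  set r : ℂ := (Real.sqrt (2 * Real.pi) : ℂ) with hr
  have hr0 : r ≠ 0 := sqrt_two_pi_ne_zero
  constructor
  · rintro ⟨g, F, hfg, hF, hper, rfl⟩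
    obtain ⟨h1, h2⟩ := hfg.inner_waveL2_of_periodic hF hper
    refine ⟨_, h2, fun k => ?_⟩
    rw [inner_add_right, inner_smul_right, inner_smul_right, h1, ← hr]
    have h3 : r * r⁻¹ = 1 := mul_inv_cancel₀ hr0
    linear_combination (-(k : ℂ) * inner ℂ (waveL2 k) f) * Complex.I_mul_I
      - (F (2 * Real.pi) * inner ℂ (waveL2 k) K) * h3
  · rintro ⟨s, hs, hh⟩
    -- Unconditional summability in `ℂ` is absolute, so the Fourier series supplies the continuous
    -- representative and its boundary values.
    have hrep := isContinuousRep_tsum hs.summable.norm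
    have hF1 : ∑' k, inner ℂ (waveL2 k) f * wave k (2 * Real.pi) = s * r⁻¹ := by
      simp only [wave_two_pi]
      rw [tsum_mul_right, hs.tsum_eq]
    have hF0 : ∑' k, inner ℂ (waveL2 k) f * wave k 0 = s * r⁻¹ := by
      simp only [wave_zero_right]
      rw [tsum_mul_right, hs.tsum_eq]
    refine ⟨-Complex.I • (h - (s * r⁻¹) • K), _, hasWeakDeriv_of_inner_waveL2 fun k => ?_, hrep,
      hF0.trans hF1.symm, ?_⟩
    · rw [inner_smul_right, inner_sub_right, inner_smul_right, hh]
      ring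
    · simp only [hF1]
      rw [smul_smul, mul_neg, Complex.I_mul_I, neg_neg, one_smul, sub_add_cancel]

end NonlocalMomentum

end

theorem theorem3p20 (K : NonlocalMomentum.L2) :
    NonlocalMomentum.RootVectorsFormRieszBasis (NonlocalMomentum.momentumOp K) ∧
      NonlocalMomentum.RootVectorsFormRieszBasis (NonlocalMomentum.momentumOp K).adjoint :=
  (NonlocalMomentum.isDiagonalPlusSum_momentumOp K).rootVectorsFormRieszBasis
    (NonlocalMomentum.dense_domain_momentumOp K)
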